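/- **Setting.** Let $X$ be a finite simplicial complex that is pure of dimension $n\ge 1$ (every simplex, including the empty one, lies in an $n$-simplex). $X^{(j)}$ is its set of $j$-simplices, with $X^{(-1)}=\{\emptyset\}$. A *weight* on $X$ is a function $m$, positive on all simplices (including $\emptyset$), with $m(\tau)=\sum_{\sigma\in X^{(j+1)},\,\tau\subset\sigma}m(\sigma)$ for all $\tau\in X^{(j)}$, $-1\le j\le n-1$. The *homogeneous weight* is $m(\tau)=(n-\dim\tau)!\,|\{\sigma\in X^{(n)}:\tau\subseteq\sigma\}|$. The link $X_\tau=\{\sigma:\sigma\cap\tau=\emptyset,\ \sigma\cup\tau\in X\}$ (so $X_\emptyset=X$) carries the weight $m_\tau(\sigma)=m(\tau\cup\sigma)$. We say that *the links of $X$ are connected* if $X$ and all its links of dimension $>0$ are connected. On $X_\tau$ let $(d_\tau\varphi)(u,v)=\varphi(v)-\varphi(u)$ map $0$-forms (functions on vertices) to $1$-forms (antisymmetric functions on ordered edges), and put $\Delta^+_{\tau,0}=d_\tau^*d_\tau$, the adjoint being taken for $\langle\varphi,\psi\rangle=\sum_v m_\tau(v)\varphi(v)\psi(v)$ on $0$-forms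 and $\langle\varphi,\psi\rangle=\sum_{(u,v)}\tfrac12 m_\tau(uv)\varphi(u,v)\psi(u,v)$ on $1$-forms. **The Cheeger constants.** Let $0\le k\le n-1$, and let $U_0,\dots,U_k\subseteq X^{(0)}$ be non-empty and pairwise disjoint. Let $X(U_0,\dots,U_k)$ be the subcomplex of those simplices of $X$ whose vertices lie in distinct sets $U_i$, and let $m(U_0,\dots,U_k)$ be the sum of $m(\sigma)$ over its $k$-simplices $\sigma$. Suppose $m(U_0,\dots,U_k)\ne 0$. With $W=X^{(0)}\setminus\bigcup_i U_i$, put $h^k_{out}(U_0,\dots,U_k)=m(U_0,\dots,U_k,W)/m(U_0,\dots,U_k)$, or $0$ if $W=\emptyset$. For a complex $Y$ let $Y_{k-1}$ be the graph with vertex set $Y^{(k-1)}$ in which, for $k\ge1$, two distinct simplices $\tau_1,\tau_2$ are joined by an edge if $\tau_1\cup\tau_2\in Y^{(k)}$; for $k=0$ it has the single vertex $\emptyset$ and one loop for every $v\in Y^{(0)}$. Give an edge of $X_{k-1}$ the conductance $m(\tau_1\cup\tau_2)$ (resp. $m(v)$ for the loop $v$), let $\nu(\tau)$ be the sum of the conductances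 of the edges at $\tau$ (a loop being counted once), and consider the random walk on $X_{k-1}$ that crosses an edge $e$ at $\tau$ with probability $c(e)/\nu(\tau)$. Let $X_{k-1}(U_0,\dots,U_k)$ be the subgraph $Y_{k-1}$ for $Y=X(U_0,\dots,U_k)$. Start the walk on $X_{k-1}$ at a random vertex of this subgraph, with probability proportional to $\nu$. Then $h^k_{inner}(U_0,\dots,U_k)$ is the conditional probability that both of the first two steps use edges of the subgraph, given that the first step does (and $0$ if the subgraph has no edge). Finally $$h^k(X)=\max\Big\{\varepsilon\ge0:\ \big(\tfrac{k}{k+1}+\varepsilon\big)h^k_{inner}(U_0,\dots,U_k)+\tfrac1{k+1}h^k_{out}(U_0,\dots,U_k)\ge\varepsilon\Big\},$$ where the inequality is required for all non-empty pairwise disjoint $U_0,\dots,U_k\subseteq X^{(0)}$ with $m(U_0,\dots,U_k)\ne0$. **Local spectral expansion.** For a finite graph $G$ let $\lambda(G)$ be the smallest positive eigenvalue of its normalized Laplacian (entries $1$ on the diagonal, $-1/\sqrt{\deg u\deg v}$ for adjacent $u,v$, and $0$ otherwise). For $\lambda>\frac{n-1}n$, $X$ has *$\lambda$-local spectral expansion*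 if its links are connected and $\lambda(X_\tau)\ge\lambda$ for all $\tau\in X^{(n-2)}$. **Theorem.** 1. Let $X$ be a pure $n$-dimensional finite complex with connected links and a weight $m$, let $0\le k\le n-1$ and $\varepsilon>0$. If $\operatorname{Spec}(\Delta^+_{\tau,0})\setminus\{0\}\subseteq[\frac k{k+1}+\varepsilon,\infty)$ for all $\tau\in X^{(k-1)}$, then the maximum $h^k(X)$ exists and $h^k(X)\ge\varepsilon$. 2. For all $0\le k\le n-1$ there is a function $\varepsilon_k=\varepsilon_{k,n}:\mathbb R\to\mathbb R$, depending only on $k$ and $n$, with $\varepsilon_k(\lambda)>0$ for all $\lambda>\frac{n-1}n$ and $\lim_{\lambda\to1}\varepsilon_k(\lambda)=\frac1{k+1}$, such that for every pure $n$-dimensional finite complex $X$ and every $\lambda>\frac{n-1}{n}$: (a) if $X$ has connected links and a weight $m$ such that $\operatorname{Spec}(\Delta^+_{\tau,0})\setminus\{0\}\subseteq[\lambda,\infty)$ for all $\tau\in X^{(n-2)}$, then the maximum $h^k(X)$ exists and $h^k(X)\ge\varepsilon_k(\lambda)$; (b) if $X$ has $\lambda$-local spectral expansion, then for the homogeneous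 weight the maximum $h^k(X)$ exists and $h^k(X)\ge\varepsilon_k(\lambda)$. -/

import Mathlib

universe u

namespace HDX

noncomputable section

open scoped Classical in
/-- The simplices of `K` having exactly `j` vertices, i.e. `K^{(j-1)}`.  The empty simplex is the
unique simplex of dimension `-1` (it is not listed among the `faces` of a
`PreAbstractSimplicialComplex`), so `simplices K 0 = {∅}`. -/
def simplices {V : Type u} [Fintype V] (K : PreAbstractSimplicialComplex V) (j : ℕ) :
    Finset (Finset V) :=
  Finset.univ.filter fun s => (s = ∅ ∨ s ∈ K) ∧ s.card = j

open scoped Classical in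
/-- The vertex set `K^{(0)}`, as a set of elements of `V`
(elements of `V` need not all be vertices). -/
def vertexSet {V : Type u} [Fintype V] (K : PreAbstractSimplicialComplex V) : Finset V :=
  Finset.univ.filter fun v => ({v} : Finset V) ∈ K

/-- `K` is pure of dimension `n`: every simplex, the empty one included, is a face of a simplex
of dimension `n`, and there are no simplices of larger dimension. -/
def IsPure {V : Type u} [Fintype V] (K : PreAbstractSimplicialComplex V) (n : ℕ) : Prop :=
  ∀ (j : ℕ), ∀ s ∈ simplices K j, j ≤ n + 1 ∧ ∃ t ∈ simplices K (n + 1), s ⊆ t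

/-- The link of `τ` in `K`; the link of the empty simplex is `K`. -/
def link {V : Type u} [DecidableEq V] (K : PreAbstractSimplicialComplex V) (τ : Finset V) :
    PreAbstractSimplicialComplex V where
  faces := {σ | σ.Nonempty ∧ Disjoint τ σ ∧ τ ∪ σ ∈ K}
  isRelLowerSet_faces := by
    rintro σ ⟨hne, hd, hm⟩
    refine ⟨hne, fun ρ hρ hρne => ⟨hρne, Finset.disjoint_of_subset_right hρ hd, ?_⟩⟩
    exact (K.isRelLowerSet_faces hm).2 (Finset.union_subset_union_right hρ)
      (hρne.mono Finset.subset_union_right)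

/-- The `1`-skeleton of `K`, as a simple graph on the vertices of `K`. -/
def skeleton {V : Type u} [DecidableEq V] (K : PreAbstractSimplicialComplex V) :
    SimpleGraph {v : V // ({v} : Finset V) ∈ K} where
  Adj u v := u ≠ v ∧ ({u.1, v.1} : Finset V) ∈ K
  symm := ⟨fun u v h => ⟨h.1.symm, by rw [Finset.pair_comm]; exact h.2⟩⟩
  loopless := ⟨fun _ h => h.1 rfl⟩

/-- For a pure `n`-dimensional complex `X`: the complex `X` and all its links of positive dimension
are connected.  (The link of a simplex with `j` vertices has dimension `n - j`.) -/
def LinksConnected {V : Type u} [Fintype V] [DecidableEq V]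
    (X : PreAbstractSimplicialComplex V) (n : ℕ) : Prop :=
  ∀ j < n, ∀ τ ∈ simplices X j, (skeleton (link X τ)).Connected

/-- `m` is a weight function on the `n`-dimensional complex `X`: it is positive on all simplices
(the empty one included) and the weight of a simplex `τ` of dimension `< n` is the sum of the
weights of the simplices having `τ` as a facet.  Values off the simplices of `X` are irrelevant. -/
def IsWeight {V : Type u} [Fintype V] [DecidableEq V] (X : PreAbstractSimplicialComplex V) (n : ℕ)
    (m : Finset V → ℝ) : Prop :=
  (∀ j ≤ n + 1, ∀ τ ∈ simplices X j, 0 < m τ) ∧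
  (∀ j ≤ n, ∀ τ ∈ simplices X j, ∑ σ ∈ simplices X (j + 1) with τ ⊆ σ, m σ = m τ)

/-- The homogeneous weight `m(τ) = (n - dim τ)! · #{σ ∈ X^{(n)} : τ ⊆ σ}`. -/
def homogeneousWeight {V : Type u} [Fintype V] [DecidableEq V]
    (X : PreAbstractSimplicialComplex V) (n : ℕ) (τ : Finset V) : ℝ :=
  ((n + 1 - τ.card).factorial : ℝ) * (((simplices X (n + 1)).filter fun σ => τ ⊆ σ).card : ℝ)

/-- The weight induced by `m` on the link of `τ`. -/
def linkWeight {V : Type u} [DecidableEq V] (m : Finset V → ℝ) (τ : Finset V) : Finset V → ℝ :=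
  fun σ => m (τ ∪ σ)

/-! ### Forms and the upper Laplacian in degree `0` -/

/-- Ordered `1`-simplices of `K`. -/
abbrev OrderedEdge {V : Type u} [DecidableEq V] (K : PreAbstractSimplicialComplex V) : Type u :=
  {p : {v : V // ({v} : Finset V) ∈ K} × {v : V // ({v} : Finset V) ∈ K} // (skeleton K).Adj p.1 p.2}

/-- The space of `0`-forms `C⁰(K, ℝ)`: real functions on the vertices of `K`. -/
abbrev ZeroForm {V : Type u} (K : PreAbstractSimplicialComplex V) : Type u :=
  {v : V // ({v} : Finset V) ∈ K} → ℝ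

/-- The space of `1`-forms `C¹(K, ℝ)`: antisymmetric real functions on the ordered `1`-simplices. -/
def OneForm {V : Type u} [DecidableEq V] (K : PreAbstractSimplicialComplex V) :
    Submodule ℝ (OrderedEdge K → ℝ) where
  carrier := {φ | ∀ e : OrderedEdge K, φ ⟨(e.1.2, e.1.1), e.2.symm⟩ = - φ e}
  add_mem' := by
    intro a b ha hb e
    simp only [Pi.add_apply, ha e, hb e]
    ring
  zero_mem' := by intro e; simp
  smul_mem' := by
    intro c a ha e
    simp only [Pi.smul_apply, smul_eq_mul, ha e]
    ring

/-- The differential `(d φ)(v₀, v₁) = φ(v₁) - φ(v₀)`. -/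
def d0 {V : Type u} [DecidableEq V] (K : PreAbstractSimplicialComplex V) :
    ZeroForm K →ₗ[ℝ] OneForm K where
  toFun φ := ⟨fun e => φ e.1.2 - φ e.1.1, fun e => by ring⟩
  map_add' := by
    intro a b
    ext e
    simp only [Pi.add_apply, Submodule.coe_add]
    ring
  map_smul' := by
    intro c a
    ext e
    simp only [Pi.smul_apply, smul_eq_mul, Submodule.coe_smul, RingHom.id_apply]
    ring

open scoped Classical in
/-- `⟨φ, ψ⟩ = ∑_v m(v) φ(v) ψ(v)` on `0`-forms. -/
def innerZero {V : Type u} [Fintype V] (K : PreAbstractSimplicialComplex V) (m : Finset V → ℝ)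
    (φ ψ : ZeroForm K) : ℝ :=
  ∑ v : {v : V // ({v} : Finset V) ∈ K}, m {v.1} * φ v * ψ v

open scoped Classical in
/-- `⟨φ, ψ⟩ = ∑_{(u, v)} (m(uv) / 2!) φ(u, v) ψ(u, v)` on `1`-forms, the sum being over ordered
`1`-simplices. -/
def innerOne {V : Type u} [Fintype V] [DecidableEq V] (K : PreAbstractSimplicialComplex V)
    (m : Finset V → ℝ) (φ ψ : OneForm K) : ℝ :=
  ∑ e : OrderedEdge K, m {e.1.1.1, e.1.2.1} / 2 * φ.1 e * ψ.1 e

open scoped Classical in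
/-- The codifferential `(δ ψ)(u) = ∑_v (m(vu) / m(u)) ψ(v, u)`, the sum being over the vertices `v`
such that `(v, u)` is an ordered `1`-simplex.  It is the adjoint of `d0`, see
`innerOne_d0_left`. -/
def delta0 {V : Type u} [Fintype V] [DecidableEq V] (K : PreAbstractSimplicialComplex V)
    (m : Finset V → ℝ) : OneForm K →ₗ[ℝ] ZeroForm K where
  toFun ψ u := ∑ v : {v : V // ({v} : Finset V) ∈ K},
    if h : (skeleton K).Adj v u then m {v.1, u.1} / m {u.1} * ψ.1 ⟨(v, u), h⟩ else 0
  map_add' := by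
    intro a b
    ext u
    simp only [Pi.add_apply, Submodule.coe_add, ← Finset.sum_add_distrib]
    refine Finset.sum_congr rfl fun v _ => ?_
    split_ifs <;> ring
  map_smul' := by
    intro c a
    ext u
    simp only [Pi.smul_apply, smul_eq_mul, Submodule.coe_smul, RingHom.id_apply, Finset.mul_sum]
    refine Finset.sum_congr rfl fun v _ => ?_
    split_ifs <;> ring

open scoped Classical in
theorem innerOne_d0_left {V : Type u} [Fintype V] [DecidableEq V]
    (K : PreAbstractSimplicialComplex V) (m : Finset V → ℝ)
    (hm : ∀ v : V, ({v} : Finset V) ∈ K → m {v} ≠ 0) (φ : ZeroForm K) (ψ : OneForm K) :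
    innerOne K m (d0 K φ) ψ = innerZero K m φ (delta0 K m ψ) := by
  have key : ∀ F : OrderedEdge K → ℝ, ∑ e : OrderedEdge K, F e =
      ∑ u, ∑ v, if h : (skeleton K).Adj v u then F ⟨(v, u), h⟩ else 0 := by
    intro F
    have h1 : ∑ e : OrderedEdge K, F e = ∑ p : {v : V // ({v} : Finset V) ∈ K} ×
        {v : V // ({v} : Finset V) ∈ K},
        if h : (skeleton K).Adj p.1 p.2 then F ⟨p, h⟩ else 0 := by
      symm
      rw [← Finset.sum_filter_of_ne (p := fun p : {v : V // ({v} : Finset V) ∈ K} ×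
        {v : V // ({v} : Finset V) ∈ K} => (skeleton K).Adj p.1 p.2)
        (fun p _ hp => by by_contra h; exact hp (dif_neg h))]
      rw [Finset.sum_subtype (p := fun p : {v : V // ({v} : Finset V) ∈ K} ×
        {v : V // ({v} : Finset V) ∈ K} => (skeleton K).Adj p.1 p.2) _ (by simp)]
      exact Finset.sum_congr rfl fun e _ => dif_pos e.2
    rw [h1, Fintype.sum_prod_type, Finset.sum_comm]
  have swap : ∑ e : OrderedEdge K, m {e.1.1.1, e.1.2.1} / 2 * φ e.1.1 * ψ.1 e =
      - ∑ e : OrderedEdge K, m {e.1.1.1, e.1.2.1} / 2 * φ e.1.2 * ψ.1 e := by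
    rw [← Finset.sum_neg_distrib]
    refine Finset.sum_bij' (fun e _ => ⟨(e.1.2, e.1.1), e.2.symm⟩)
      (fun e _ => ⟨(e.1.2, e.1.1), e.2.symm⟩) (by simp) (by simp) (by simp) (by simp) ?_
    intro e _
    have := ψ.2 e
    simp only [this, Finset.pair_comm e.1.2.1 e.1.1.1]
    ring
  have expand : innerOne K m (d0 K φ) ψ =
      ∑ e : OrderedEdge K, m {e.1.1.1, e.1.2.1} * φ e.1.2 * ψ.1 e := by
    have : innerOne K m (d0 K φ) ψ =
        ∑ e : OrderedEdge K, m {e.1.1.1, e.1.2.1} / 2 * φ e.1.2 * ψ.1 e -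
        ∑ e : OrderedEdge K, m {e.1.1.1, e.1.2.1} / 2 * φ e.1.1 * ψ.1 e := by
      rw [← Finset.sum_sub_distrib]
      refine Finset.sum_congr rfl fun e _ => ?_
      simp only [d0, LinearMap.coe_mk, AddHom.coe_mk]
      ring
    rw [this, swap, sub_neg_eq_add, ← Finset.sum_add_distrib]
    exact Finset.sum_congr rfl fun e _ => by ring
  rw [expand, key]
  unfold innerZero
  refine Finset.sum_congr rfl fun u _ => ?_
  simp only [delta0, LinearMap.coe_mk, AddHom.coe_mk, Finset.mul_sum]
  refine Finset.sum_congr rfl fun v _ => ?_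
  have := hm u.1 u.2
  split_ifs
  · field_simp
  · simp

/-- The upper Laplacian `Δ₀⁺ = δ₀ d₀` on `C⁰(K, ℝ)`. -/
def upperLaplacian {V : Type u} [Fintype V] [DecidableEq V] (K : PreAbstractSimplicialComplex V)
    (m : Finset V → ℝ) : Module.End ℝ (ZeroForm K) :=
  delta0 K m ∘ₗ d0 K

/-- The nonzero spectrum of the upper Laplacian `Δ⁺_{τ,0}` of the link `X_τ` is contained in
`[a, ∞)`, for all simplices `τ` with `j` vertices. -/
def LinkSpectrumGE {V : Type u} [Fintype V] [DecidableEq V] (X : PreAbstractSimplicialComplex V)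
    (m : Finset V → ℝ) (j : ℕ) (a : ℝ) : Prop :=
  ∀ τ ∈ simplices X j,
    spectrum ℝ (upperLaplacian (link X τ) (linkWeight m τ)) \ {0} ⊆ Set.Ici a

/-! ### Spectral gaps of graphs and local spectral expansion -/

open scoped Classical in
/-- The normalized Laplacian matrix of a finite graph. -/
def normalizedLaplacian {W : Type u} [Fintype W] (G : SimpleGraph W) : Matrix W W ℝ :=
  Matrix.of fun u v =>
    if u = v then 1
    else if G.Adj u v then -(1 / Real.sqrt ((G.degree u : ℝ) * (G.degree v : ℝ)))
    else 0

open scoped Classical in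
/-- `λ(G)`: the smallest positive eigenvalue of the normalized Laplacian. -/
def spectralGap {W : Type u} [Fintype W] (G : SimpleGraph W) : ℝ :=
  sInf {μ : ℝ | 0 < μ ∧ μ ∈ spectrum ℝ (normalizedLaplacian G)}

open scoped Classical in
/-- `lam`-local spectral expansion of a pure `n`-dimensional complex, `n ≥ 1`: `X` and all its links
of positive dimension are connected, and all its `1`-dimensional links (those of the simplices of
dimension `n - 2`, i.e. with `n - 1` vertices) have spectral gap at least `lam`, where
`lam > (n-1)/n`. -/
def LocalSpectralExpansion {V : Type u} [Fintype V] [DecidableEq V]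
    (X : PreAbstractSimplicialComplex V) (n : ℕ) (lam : ℝ) : Prop :=
  ((n : ℝ) - 1) / n < lam ∧ IsPure X n ∧ LinksConnected X n ∧
    ∀ τ ∈ simplices X (n - 1), lam ≤ spectralGap (skeleton (link X τ))

/-! ### Random walks on multigraphs with conductances -/

open scoped Classical in
/-- `ν(v)`: the sum of the conductances of the edges at `v` (a loop is counted once). -/
def nu {α β : Type u} [Fintype β] (G : Graph α β) (c : β → ℝ) (v : α) : ℝ :=
  ∑ e : β with G.Inc e v, c e

open scoped Classical in
/-- The probability that the random walk on `G` with conductance `c`, which traverses an edge `e`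
at its current position `v` with probability `c(e) / ν(v)`, uses, when started from `v`,
successively an edge of `E₁`, an edge of `E₂`, …, an edge of `E_j`, where `[E₁, …, E_j]` is the
given list.  This is the sum of `μ(v, e₁) μ(v₂, e₂) ⋯ μ(v_j, e_j)` over the paths
`(v, e₁, …, e_j)` with `e_i ∈ E_i`. -/
def pathMu {α β : Type u} [Fintype α] [Fintype β] (G : Graph α β) (c : β → ℝ) :
    α → List (Set β) → ℝ
  | _, [] => 1
  | v, E :: L =>
      ∑ e : β, ∑ w : α, if e ∈ E ∧ G.IsLink e v w then c e / nu G c v * pathMu G c w L else 0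

open scoped Classical in
/-- The coarse path conductance `∑_{v ∈ U} ν(v) · pathμ({v}, E₁, …, E_j)`. -/
def pathC {α β : Type u} [Fintype α] [Fintype β] (G : Graph α β) (c : β → ℝ)
    (U : Set α) (L : List (Set β)) : ℝ :=
  ∑ v : α with v ∈ U, nu G c v * pathMu G c v L

open scoped Classical in
/-- The inner connectivity constant `h_inner(H ; G)` of a subgraph `H` of `G`: the conditional
probability that the two-step random walk on `G`, started at a random vertex of `H`, stays in `H`,
given that its first step stays in `H`; it is `0` if `H` has no edge. -/
def hInnerGraph {α β : Type u} [Fintype α] [Fintype β] (H G : Graph α β) (c : β → ℝ) : ℝ :=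
  if H.edgeSet = ∅ then 0
  else pathC G c H.vertexSet [H.edgeSet, H.edgeSet] / pathC G c H.vertexSet [H.edgeSet]

/-! ### The graphs `X_k` and the higher Cheeger constant -/

/-- The graph `X_{j-1}`, whose vertices are the simplices of `K` with `j` vertices.  Its edges are
labelled by pairs `(σ, {τ₁, τ₂})`, where `σ` is a simplex with `j + 1` vertices having `τ₁` and `τ₂`
as facets.  For `j ≥ 1` one requires `τ₁ ≠ τ₂`, so that `σ = τ₁ ∪ τ₂` and there are no multiple
edges.  For `j = 0` this is a single vertex `∅` with one loop for every vertex of `K`. -/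
def simplexGraph {V : Type u} [Fintype V] (K : PreAbstractSimplicialComplex V) (j : ℕ) :
    Graph (Finset V) (Finset V × Sym2 (Finset V)) where
  vertexSet := {τ | τ ∈ simplices K j}
  IsLink e τ₁ τ₂ := e.2 = s(τ₁, τ₂) ∧ e.1 ∈ simplices K (j + 1) ∧
    τ₁ ∈ simplices K j ∧ τ₂ ∈ simplices K j ∧ τ₁ ⊆ e.1 ∧ τ₂ ⊆ e.1 ∧ (j = 0 ∨ τ₁ ≠ τ₂)
  isLink_symm := by
    intro e _
    refine ⟨fun a b h => ?_⟩
    obtain ⟨h1, h2, h3, h4, h5, h6, h7⟩ := h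
    exact ⟨h1.trans Sym2.eq_swap, h2, h4, h3, h6, h5, h7.imp id Ne.symm⟩
  eq_or_eq_of_isLink_of_isLink := by
    intro e x y v w h h'
    have := h.1.symm.trans h'.1
    rw [Sym2.eq_iff] at this
    tauto
  left_mem_of_isLink := fun _ _ _ h => h.2.2.1

/-- The conductance on `X_{j-1}` induced by a weight `m`: an edge `(σ, {τ₁, τ₂})` gets the weight
of `σ` (which is `m(τ₁ ∪ τ₂)` for `j ≥ 1`, and `m(v)` on the loop given by `v` for `j = 0`). -/
def simplexConductance {V : Type u} (m : Finset V → ℝ) :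
    Finset V × Sym2 (Finset V) → ℝ :=
  fun e => m e.1

/-- The subcomplex `X(U_0, …, U_l)` spanned by `U_0, …, U_l`: the simplices whose vertices can be
assigned to pairwise distinct indices `i` in such a way that each vertex lies in the set `U i`. -/
def spanned {V : Type u} (X : PreAbstractSimplicialComplex V) {l : ℕ} (U : Fin l → Finset V) :
    PreAbstractSimplicialComplex V where
  faces := {σ | σ ∈ X ∧ ∃ f : V → Fin l, Set.InjOn f (σ : Set V) ∧ ∀ v ∈ σ, v ∈ U (f v)}
  isRelLowerSet_faces := by
    rintro σ ⟨hσ, f, hf, hU⟩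
    have h := X.isRelLowerSet_faces hσ
    exact ⟨h.1, fun ρ hρ hne =>
      ⟨h.2 hρ hne, f, hf.mono (Finset.coe_subset.2 hρ), fun v hv => hU v (hρ hv)⟩⟩

/-- `m(U_0, …, U_{l-1})`: the total weight of the `(l-1)`-simplices of the complex spanned by the
`l` sets `U_0, …, U_{l-1}`. -/
def setWeight {V : Type u} [Fintype V] (X : PreAbstractSimplicialComplex V) (m : Finset V → ℝ)
    {l : ℕ} (U : Fin l → Finset V) : ℝ :=
  ∑ τ ∈ simplices (spanned X U) l, m τ

/-- `h_inner^k(U_0, …, U_k)`: the inner connectivity of `X_{k-1}(U_0, …, U_k)` in `X_{k-1}`. -/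
def hInner {V : Type u} [Fintype V] (X : PreAbstractSimplicialComplex V) (m : Finset V → ℝ)
    (k : ℕ) (U : Fin (k + 1) → Finset V) : ℝ :=
  hInnerGraph (simplexGraph (spanned X U) k) (simplexGraph X k) (simplexConductance m)

open scoped Classical in
/-- `h_out^k(U_0, …, U_k)`. -/
def hOut {V : Type u} [Fintype V] (X : PreAbstractSimplicialComplex V) (m : Finset V → ℝ)
    (k : ℕ) (U : Fin (k + 1) → Finset V) : ℝ :=
  if vertexSet X \ Finset.univ.biUnion U = ∅ then 0
  else setWeight X m (Fin.snoc (α := fun _ => Finset V) U (vertexSet X \ Finset.univ.biUnion U)) /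
    setWeight X m U

/-- The set of `ε ≥ 0` whose maximum is the higher Cheeger constant `h^k(X)`.  The families
`U_0, …, U_k` range over those with `m(U_0, …, U_k) ≠ 0`, i.e. for which the quotient `h_out^k` is
defined. -/
def cheegerSet {V : Type u} [Fintype V] (X : PreAbstractSimplicialComplex V) (m : Finset V → ℝ)
    (k : ℕ) : Set ℝ :=
  {ε | 0 ≤ ε ∧ ∀ U : Fin (k + 1) → Finset V,
    (∀ i, U i ⊆ vertexSet X) → (∀ i, (U i).Nonempty) → Pairwise (fun i j => Disjoint (U i) (U j)) →
    setWeight X m U ≠ 0 →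
    ε ≤ ((k : ℝ) / (k + 1) + ε) * hInner X m k U + 1 / ((k : ℝ) + 1) * hOut X m k U}

/-- The higher Cheeger constant `h^k(X)`. -/
def higherCheeger {V : Type u} [Fintype V] (X : PreAbstractSimplicialComplex V)
    (m : Finset V → ℝ) (k : ℕ) : ℝ :=
  sSup (cheegerSet X m k)

end

end HDX

/-! The two parts rest on two inequalities, both obtained by summing over links.

For a family `U_0, …, U_k` let `Y = X(U_0, …, U_k)`, and let `d(τ)` be the weight of the `k`-simplices
of `Y` containing a `(k-1)`-simplex `τ` of `Y`.  The walk on `X_{k-1}` is reversible, whence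
`h_inner = ∑ d(τ)² / m(τ) / ((k + 1) m(U_0, …, U_k))` (`hInner_eq`).  The indicator of the vertices
`u` of the link `X_τ` with `τ ∪ {u} ∈ Y` has total weight `d(τ)`, and hence variance
`d(τ) - d(τ)² / m(τ)`; its Dirichlet energy is the weight of a cut in `X_τ`.  Summed over `τ`, the
cuts amount to at most `k m(U_0, …, U_k) + m(U_0, …, U_k, W)`: a vertex `v` joined to a `k`-simplex
`σ` of `Y` is counted for all `k + 1` facets of `σ` if `v ∈ W`, and for all but one of them
otherwise.  Comparing the two by the Poincaré inequality in each `X_τ` (`linkPoincare_of_spectrum`: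
the links are connected, so the kernel of the Laplacian consists of the constants) yields
`cheeger_inequality`.  The set whose maximum is `h^k(X)` is closed, and it is bounded because some
family of singletons has `h_inner < 1` (`exists_hInner_lt_one`).

Spectral gaps descend from the links of `τ ∪ {w}` to the link of `τ`: if the former have gap `a`,
the latter has gap `2 - 1 / a` (`spectrum_subset_of_linkPoincare`).  Iterating from dimension `n - 2`
down to `k - 1` turns a gap `lam > (n - 1) / n` into a gap above `k / (k + 1)`, and the excess is the
constant `cheegerBound n k lam`.  For the homogeneous weight, the Laplacian of a one-dimensional link
is the random walk Laplacian of its graph, which is conjugate to the normalized Laplacian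
(`spectralGap_le`). -/

namespace HDX

noncomputable section

/-! ### Self-adjoint operators for a weighted inner product -/

/-- The spectral theorem in variational form: off its kernel, a symmetric operator is bounded below
by any lower bound of its nonzero eigenvalues. -/
theorem mul_norm_sq_le_inner_of_eigenvalue_bound {E : Type*} [NormedAddCommGroup E]
    [InnerProductSpace ℝ E] [FiniteDimensional ℝ E] {T : E →ₗ[ℝ] E} (hT : T.IsSymmetric) {a : ℝ}
    (h : ∀ μ : ℝ, μ ≠ 0 → ∀ y : E, y ≠ 0 → T y = μ • y → a ≤ μ)
    {x : E} (hx : ∀ y, T y = 0 → inner ℝ y x = 0) :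
    a * inner ℝ x x ≤ inner ℝ (T x) x := by
  set b := hT.eigenvectorBasis rfl with hb
  have hTb : ∀ i, T (b i) = (hT.eigenvalues rfl i) • b i := fun i => hT.apply_eigenvectorBasis rfl i
  have hb0 : ∀ i, b i ≠ 0 := fun i => b.orthonormal.ne_zero i
  rw [← b.sum_inner_mul_inner x x, ← b.sum_inner_mul_inner (T x) x, Finset.mul_sum]
  refine Finset.sum_le_sum fun i _ => ?_
  rw [hT x (b i), hTb, inner_smul_right, real_inner_comm (b i) x]
  by_cases hi : hT.eigenvalues rfl i = 0
  · have : inner ℝ (b i) x = 0 := hx _ (by rw [hTb, hi, zero_smul])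
    simp [this]
  · have := h _ hi (b i) (hb0 i) (hTb i)
    nlinarith [mul_self_nonneg (inner ℝ (b i) x)]

/-- A Poincaré inequality: an operator on functions which is self-adjoint for the weights `w`,
whose kernel consists of the constants and whose nonzero spectrum is bounded below by `a`, has
quadratic form at least `a` times the (weighted) variance. -/
theorem weighted_poincare {W : Type*} [Fintype W] {w : W → ℝ} (hw : ∀ u, 0 < w u)
    {L : Module.End ℝ (W → ℝ)}
    (hL : ∀ φ ψ : W → ℝ, ∑ u, w u * L φ u * ψ u = ∑ u, w u * φ u * L ψ u)
    (hker : ∀ φ, L φ = 0 → ∀ u v, φ u = φ v) (hone : L (fun _ => 1) = 0) {a : ℝ}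
    (h : spectrum ℝ L \ {0} ⊆ Set.Ici a) (φ : W → ℝ) :
    a * (∑ u, w u * φ u ^ 2 - (∑ u, w u * φ u) ^ 2 / ∑ u, w u) ≤ ∑ u, w u * L φ u * φ u := by
  rcases isEmpty_or_nonempty W with hW | hW
  · simp
  have htot : 0 < ∑ u, w u := Finset.sum_pos (fun u _ => hw u) Finset.univ_nonempty
  set c : ℝ := (∑ u, w u * φ u) / ∑ u, w u with hc
  have hs : ∀ u, Real.sqrt (w u) * Real.sqrt (w u) = w u := fun u => Real.mul_self_sqrt (hw u).le
  have hs0 : ∀ u, Real.sqrt (w u) ≠ 0 := fun u => (Real.sqrt_pos.2 (hw u)).ne'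
  -- multiplication by `√w` is an isometry onto the standard Euclidean space
  let D : (W → ℝ) ≃ₗ[ℝ] EuclideanSpace ℝ W :=
    { toFun := fun f => WithLp.toLp 2 fun u => Real.sqrt (w u) * f u
      invFun := fun x u => (Real.sqrt (w u))⁻¹ * x u
      map_add' := fun f g => by ext u; simp [mul_add]
      map_smul' := fun r f => by ext u; simp; ring
      left_inv := fun f => by ext u; simp [hs0 u]
      right_inv := fun x => by ext u; simp [hs0 u] }
  have hD : ∀ f u, D f u = Real.sqrt (w u) * f u := fun f u => rfl
  have hinner : ∀ f g, inner ℝ (D f) (D g) = ∑ u, w u * f u * g u := fun f g => by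
    rw [PiLp.inner_apply]
    refine Finset.sum_congr rfl fun u _ => ?_
    rw [hD, hD, RCLike.inner_apply, conj_trivial]
    linear_combination (f u * g u) * hs u
  set T : EuclideanSpace ℝ W →ₗ[ℝ] EuclideanSpace ℝ W := D.conj L with hTdef
  have hTD : ∀ f, T (D f) = D (L f) := fun f => by simp [hTdef, LinearEquiv.conj_apply]
  have hT : T.IsSymmetric := fun x y => by
    obtain ⟨f, rfl⟩ := D.surjective x
    obtain ⟨g, rfl⟩ := D.surjective y
    rw [hTD, hTD, hinner, hinner, hL]
  set ψ : W → ℝ := φ - c • (fun _ => (1 : ℝ)) with hψ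
  have hLψ : L ψ = L φ := by rw [hψ, map_sub, map_smul, hone, smul_zero, sub_zero]
  have hψu : ∀ u, ψ u = φ u - c := fun u => by simp [hψ]
  have hmean : ∑ u, w u * ψ u = 0 := by
    simp only [hψu, mul_sub, Finset.sum_sub_distrib, ← Finset.sum_mul]
    rw [hc]; field_simp; ring
  have key := mul_norm_sq_le_inner_of_eigenvalue_bound hT (a := a) (x := D ψ) ?_ ?_
  · rw [hTD, hinner, hinner, hLψ] at key
    have e1 : ∑ u, w u * ψ u * ψ u = ∑ u, w u * φ u ^ 2 - (∑ u, w u * φ u) ^ 2 / ∑ u, w u := by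
      have : ∀ u, w u * ψ u * ψ u = w u * φ u ^ 2 - 2 * c * (w u * φ u) + c ^ 2 * w u :=
        fun u => by rw [hψu]; ring
      simp only [this, Finset.sum_add_distrib, Finset.sum_sub_distrib, ← Finset.mul_sum]
      rw [hc]; field_simp; ring
    have e2 : ∑ u, w u * L φ u * ψ u = ∑ u, w u * L φ u * φ u := by
      have h0 : ∑ u, w u * L φ u * 1 = 0 := by
        rw [hL φ (fun _ => 1), hone]; simp
      have : ∀ u, w u * L φ u * ψ u = w u * L φ u * φ u - c * (w u * L φ u * 1) :=
        fun u => by rw [hψu]; ring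
      simp only [this, Finset.sum_sub_distrib, ← Finset.mul_sum, h0]
      ring
    rwa [e1, e2] at key
  · intro μ hμ y hy hTy
    obtain ⟨f, rfl⟩ := D.surjective y
    rw [hTD, ← map_smul] at hTy
    have hev : Module.End.HasEigenvector L μ f :=
      ⟨Module.End.mem_eigenspace_iff.2 (D.injective hTy), fun h0 => hy (by rw [h0, map_zero])⟩
    exact h ⟨(Module.End.hasEigenvalue_of_hasEigenvector hev).mem_spectrum, hμ⟩
  · intro y hy
    obtain ⟨f, rfl⟩ := D.surjective y
    rw [hTD] at hy
    have hf := hker f (by simpa using hy)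
    obtain ⟨u₀⟩ := hW
    rw [hinner]
    have : ∀ u, w u * f u * ψ u = f u₀ * (w u * ψ u) := fun u => by rw [hf u u₀]; ring
    simp only [this, ← Finset.mul_sum, hmean, mul_zero]

/-! ### Weights of simplices, vertices and edges in links -/

variable {V : Type u}

theorem mem_of_subset {K : PreAbstractSimplicialComplex V} {s t : Finset V} (h : t ∈ K)
    (hst : s ⊆ t) (hs : s.Nonempty) : s ∈ K := (K.isRelLowerSet_faces h).2 hst hs

theorem empty_or_mem_of_subset {K : PreAbstractSimplicialComplex V} {s t : Finset V}
    (h : t = ∅ ∨ t ∈ K) (hst : s ⊆ t) : s = ∅ ∨ s ∈ K := by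
  rcases s.eq_empty_or_nonempty with rfl | hs
  · exact Or.inl rfl
  · rcases h with rfl | h
    · exact Or.inl (Finset.subset_empty.1 hst)
    · exact Or.inr (mem_of_subset h hst hs)

variable [Fintype V]

theorem mem_simplices {K : PreAbstractSimplicialComplex V} {j : ℕ} {s : Finset V} :
    s ∈ simplices K j ↔ (s = ∅ ∨ s ∈ K) ∧ s.card = j := by
  simp [simplices]

theorem mem_simplices_of_subset {K : PreAbstractSimplicialComplex V} {j : ℕ} {s t : Finset V}
    (h : t ∈ simplices K j) (hst : s ⊆ t) : s ∈ simplices K s.card :=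
  mem_simplices.2 ⟨empty_or_mem_of_subset (mem_simplices.1 h).1 hst, rfl⟩

theorem mem_of_mem_simplices_succ {K : PreAbstractSimplicialComplex V} {j : ℕ} {s : Finset V}
    (h : s ∈ simplices K (j + 1)) : s ∈ K := by
  obtain ⟨h1 | h1, h2⟩ := mem_simplices.1 h
  · simp [h1] at h2
  · exact h1

theorem IsWeight.pos [DecidableEq V] {X : PreAbstractSimplicialComplex V} {n : ℕ}
    {m : Finset V → ℝ} (hm : IsWeight X n m) (hX : IsPure X n) {j : ℕ} {τ : Finset V}
    (hτ : τ ∈ simplices X j) : 0 < m τ :=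
  hm.1 j (hX j τ hτ).1 τ hτ

variable [DecidableEq V]

open scoped Classical in
/-- The weight `m` extended by zero to the sets which are not simplices of `X`. -/
def extWeight (X : PreAbstractSimplicialComplex V) (m : Finset V → ℝ) (s : Finset V) : ℝ :=
  if s = ∅ ∨ s ∈ X then m s else 0

/-- The weight of `u` as a vertex of the link of `τ`; it is `0` if `u` is not such a vertex. -/
def vertexWeight (X : PreAbstractSimplicialComplex V) (m : Finset V → ℝ) (τ : Finset V) (u : V) :
    ℝ :=
  if u ∈ τ then 0 else extWeight X m (insert u τ)

/-- The weight of `uv` as an edge of the link of `τ`; it is `0` if `uv` is not such an edge. -/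
def edgeWeight (X : PreAbstractSimplicialComplex V) (m : Finset V → ℝ) (τ : Finset V) (u v : V) :
    ℝ :=
  if u ∈ τ then 0 else vertexWeight X m (insert u τ) v

open scoped Classical in
theorem vertexWeight_eq {V : Type u} [DecidableEq V] (X : PreAbstractSimplicialComplex V)
    (m : Finset V → ℝ) (τ : Finset V) (u : V) :
    vertexWeight X m τ u = if u ∉ τ ∧ insert u τ ∈ X then m (insert u τ) else 0 := by
  by_cases h : u ∈ τ <;> simp [vertexWeight, extWeight, h]

open scoped Classical in
theorem edgeWeight_eq {V : Type u} [DecidableEq V] (X : PreAbstractSimplicialComplex V)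
    (m : Finset V → ℝ) (τ : Finset V) (u v : V) :
    edgeWeight X m τ u v =
      if u ∉ τ ∧ v ∉ τ ∧ u ≠ v ∧ insert v (insert u τ) ∈ X then
        m (insert v (insert u τ)) else 0 := by
  unfold edgeWeight
  rw [vertexWeight_eq]
  by_cases h : u ∈ τ <;> simp [h, and_assoc, eq_comm, and_left_comm]

theorem edgeWeight_comm {V : Type u} [DecidableEq V] (X : PreAbstractSimplicialComplex V)
    (m : Finset V → ℝ) (τ : Finset V) (u v : V) : edgeWeight X m τ u v = edgeWeight X m τ v u := by
  classical
  rw [edgeWeight_eq, edgeWeight_eq, Finset.insert_comm]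
  congr 1
  simp only [eq_iff_iff, ne_comm (a := u)]
  tauto

/-- The simplices covering a `j`-set `τ` correspond to the vertices of its link. -/
theorem sum_simplices_superset (X : PreAbstractSimplicialComplex V) (m : Finset V → ℝ) {j : ℕ}
    {τ : Finset V} (hτ : τ.card = j) :
    ∑ σ ∈ simplices X (j + 1) with τ ⊆ σ, m σ = ∑ u, vertexWeight X m τ u := by
  classical
  simp only [vertexWeight_eq]
  rw [← Finset.sum_filter]
  symm
  refine Finset.sum_bij (fun u _ => insert u τ) ?_ ?_ ?_ (fun _ _ => rfl)
  · intro u hu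
    simp only [Finset.mem_filter, Finset.mem_univ, true_and] at hu
    simp only [Finset.mem_filter, mem_simplices]
    exact ⟨⟨Or.inr hu.2, by rw [Finset.card_insert_of_notMem hu.1, hτ]⟩, Finset.subset_insert _ _⟩
  · intro u hu v hv huv
    simp only [Finset.mem_filter, Finset.mem_univ, true_and] at hu hv
    have : u ∈ insert v τ := huv ▸ Finset.mem_insert_self u τ
    exact (Finset.mem_insert.1 this).resolve_right hu.1
  · intro σ hσ
    obtain ⟨h1, h2⟩ := Finset.mem_filter.1 hσ
    have hc := (mem_simplices.1 h1).2
    obtain ⟨u, hu, rfl⟩ := (Finset.covBy_iff_exists_insert.1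
      (Finset.covBy_iff_card_sdiff_eq_one.2 ⟨h2, by
        rw [Finset.card_sdiff_of_subset h2]; omega⟩) : ∃ a ∉ τ, insert a τ = σ)
    exact ⟨u, by simp [hu, mem_of_mem_simplices_succ h1], rfl⟩

variable {X : PreAbstractSimplicialComplex V} {n : ℕ} {m : Finset V → ℝ}

theorem IsWeight.pos_of_mem (hm : IsWeight X n m) (hX : IsPure X n) {τ : Finset V}
    (hτ : τ ∈ X) : 0 < m τ :=
  hm.pos hX (mem_simplices.2 ⟨Or.inr hτ, rfl⟩)

theorem IsWeight.vertexWeight_nonneg (hm : IsWeight X n m) (hX : IsPure X n) (τ : Finset V)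
    (u : V) : 0 ≤ vertexWeight X m τ u := by
  classical
  rw [vertexWeight_eq]
  split_ifs with h
  · exact (hm.pos_of_mem hX h.2).le
  · exact le_rfl

theorem IsWeight.edgeWeight_nonneg (hm : IsWeight X n m) (hX : IsPure X n) (τ : Finset V)
    (u v : V) : 0 ≤ edgeWeight X m τ u v := by
  unfold edgeWeight
  split_ifs
  · exact le_rfl
  · exact hm.vertexWeight_nonneg hX _ _

theorem IsWeight.sum_vertexWeight (hm : IsWeight X n m) {τ : Finset V} (hτ : τ.card ≤ n) :
    ∑ u, vertexWeight X m τ u = extWeight X m τ := by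
  classical
  by_cases h : τ = ∅ ∨ τ ∈ X
  · rw [← sum_simplices_superset X m rfl, hm.2 _ hτ τ (mem_simplices.2 ⟨h, rfl⟩), extWeight,
      if_pos h]
  · rw [extWeight, if_neg h]
    refine Finset.sum_eq_zero fun u _ => ?_
    rw [vertexWeight_eq, if_neg]
    exact fun hu => h (empty_or_mem_of_subset (Or.inr hu.2) (Finset.subset_insert u τ))

theorem IsWeight.sum_edgeWeight (hm : IsWeight X n m) {τ : Finset V} (hτ : τ.card < n) (u : V) :
    ∑ v, edgeWeight X m τ u v = vertexWeight X m τ u := by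
  by_cases h : u ∈ τ
  · simp [edgeWeight, vertexWeight, h]
  · simp only [edgeWeight, vertexWeight, h, if_false]
    exact hm.sum_vertexWeight (by rw [Finset.card_insert_of_notMem h]; omega)

theorem IsWeight.sum_edgeWeight_insert (hm : IsWeight X n m) {τ : Finset V}
    (hτ : τ.card + 1 < n) (u v : V) :
    ∑ w, (if w ∈ τ then 0 else edgeWeight X m (insert w τ) u v) = edgeWeight X m τ u v := by
  classical
  by_cases h : u ∉ τ ∧ v ∉ τ ∧ u ≠ v
  · obtain ⟨hu, hv, huv⟩ := h
    have hv' : v ∉ insert u τ := by simp [hv, huv.symm]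
    have hsum := hm.sum_vertexWeight (τ := insert v (insert u τ)) (by
      rw [Finset.card_insert_of_notMem hv', Finset.card_insert_of_notMem hu]; omega)
    rw [edgeWeight, if_neg hu, vertexWeight, if_neg hv', ← hsum]
    refine Finset.sum_congr rfl fun w _ => ?_
    rw [edgeWeight_eq, vertexWeight_eq]
    have e : insert v (insert u (insert w τ)) = insert w (insert v (insert u τ)) := by
      ext x; simp only [Finset.mem_insert]; tauto
    rw [e]
    simp only [Finset.mem_insert, hu, hv, or_false, not_or, ne_eq, huv, not_false_eq_true, true_and]
    by_cases hw : w ∈ τ <;> simp [hw, eq_comm (a := w), and_assoc, and_left_comm]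
  · have h1 : edgeWeight X m τ u v = 0 := by
      rw [edgeWeight_eq, if_neg]; tauto
    rw [h1]
    refine Finset.sum_eq_zero fun w _ => ?_
    split_ifs
    · rfl
    · rw [edgeWeight_eq, if_neg]
      simp only [Finset.mem_insert]
      tauto

end

noncomputable section

variable {V : Type u} [Fintype V] [DecidableEq V] {X : PreAbstractSimplicialComplex V} {n : ℕ}
  {m : Finset V → ℝ}

/-! ### The Laplacian of a link -/

theorem singleton_mem_link {V : Type u} [DecidableEq V] {X : PreAbstractSimplicialComplex V}
    {τ : Finset V} {v : V} : {v} ∈ link X τ ↔ v ∉ τ ∧ insert v τ ∈ X := by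
  change (_ ∧ _ ∧ _) ↔ _
  rw [Finset.union_comm, ← Finset.insert_eq]
  simp

theorem skeleton_link_adj {V : Type u} [DecidableEq V] {X : PreAbstractSimplicialComplex V}
    {τ : Finset V} {u v : {v : V // ({v} : Finset V) ∈ link X τ}} :
    (skeleton (link X τ)).Adj u v ↔
      u.1 ∉ τ ∧ v.1 ∉ τ ∧ u.1 ≠ v.1 ∧ insert v.1 (insert u.1 τ) ∈ X := by
  change (u ≠ v ∧ _ ∧ _ ∧ _) ↔ _
  have e : τ ∪ {u.1, v.1} = insert v.1 (insert u.1 τ) := by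
    ext x; simp only [Finset.mem_union, Finset.mem_insert, Finset.mem_singleton]; tauto
  have h1 := (singleton_mem_link.1 u.2).1
  have h2 := (singleton_mem_link.1 v.2).1
  rw [e]
  simp [h1, h2, Subtype.ext_iff]

theorem linkWeight_singleton {V : Type u} [DecidableEq V] (m : Finset V → ℝ) (τ : Finset V)
    (v : V) : linkWeight m τ {v} = m (insert v τ) := by
  rw [linkWeight, Finset.union_comm, ← Finset.insert_eq]

theorem sum_subtype_of_eq_zero {α : Type*} [Fintype α] (p : α → Prop) [Fintype {a // p a}]
    (F : α → ℝ) (h : ∀ a, ¬ p a → F a = 0) : ∑ a : {a // p a}, F a = ∑ a, F a := by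
  classical
  rw [← Finset.sum_filter_of_ne (p := p) (s := Finset.univ) (f := F)
    fun a _ ha => by_contra fun hp => ha (h a hp)]
  exact (Finset.sum_subtype _ (by simp) F).symm

/-- Summation by parts for symmetric edge weights. -/
theorem sum_sum_mul_sub_mul {α : Type*} [Fintype α] {e : α → α → ℝ} (he : ∀ u v, e u v = e v u)
    (f g : α → ℝ) :
    ∑ u, ∑ v, e u v * (f u - f v) * g u = 1 / 2 * ∑ u, ∑ v, e u v * (f u - f v) * (g u - g v) := by
  have h1 : ∑ u, ∑ v, e u v * (f u - f v) * g v = - ∑ u, ∑ v, e u v * (f u - f v) * g u := by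
    rw [Finset.sum_comm, ← Finset.sum_neg_distrib]
    refine Finset.sum_congr rfl fun u _ => ?_
    rw [← Finset.sum_neg_distrib]
    exact Finset.sum_congr rfl fun v _ => by rw [he v u]; ring
  simp only [mul_sub (_ * _), Finset.sum_sub_distrib, h1]
  ring

theorem vertexWeight_eq_zero {V : Type u} [DecidableEq V] {X : PreAbstractSimplicialComplex V}
    {m : Finset V → ℝ} {τ : Finset V} {u : V} (h : ¬ {u} ∈ link X τ) :
    vertexWeight X m τ u = 0 := by
  classical
  rw [vertexWeight_eq, if_neg (by rwa [singleton_mem_link] at h)]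

theorem vertexWeight_of_mem {V : Type u} [DecidableEq V] {X : PreAbstractSimplicialComplex V}
    {m : Finset V → ℝ} {τ : Finset V} {u : V} (h : {u} ∈ link X τ) :
    vertexWeight X m τ u = m (insert u τ) := by
  classical
  rw [vertexWeight_eq, if_pos (by rwa [singleton_mem_link] at h)]

theorem edgeWeight_eq_zero_left {V : Type u} [DecidableEq V] {X : PreAbstractSimplicialComplex V}
    {m : Finset V → ℝ} {τ : Finset V} {u : V} (h : ¬ {u} ∈ link X τ) (v : V) :
    edgeWeight X m τ u v = 0 := by
  classical
  rw [edgeWeight_eq, if_neg]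
  rintro ⟨h1, -, -, h2⟩
  exact h (singleton_mem_link.2 ⟨h1, mem_of_subset h2 (Finset.subset_insert _ _) (by simp)⟩)

/-- The upper Laplacian of a link in terms of sums over all of `V`.  The function `f` may take
arbitrary values off the vertices of the link. -/
theorem vertexWeight_mul_upperLaplacian (hX : IsPure X n) (hm : IsWeight X n m) {τ : Finset V}
    {φ : ZeroForm (link X τ)} {f : V → ℝ} (hf : ∀ u, f u.1 = φ u)
    (u : {v : V // ({v} : Finset V) ∈ link X τ}) :
    vertexWeight X m τ u.1 * upperLaplacian (link X τ) (linkWeight m τ) φ u =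
      ∑ v, edgeWeight X m τ u.1 v * (f u.1 - f v) := by
  classical
  have hpos : m (insert u.1 τ) ≠ 0 := (hm.pos_of_mem hX (singleton_mem_link.1 u.2).2).ne'
  rw [vertexWeight_of_mem u.2, ← sum_subtype_of_eq_zero (fun v : V => ({v} : Finset V) ∈ link X τ)]
  · simp only [upperLaplacian, LinearMap.comp_apply, delta0, d0, LinearMap.coe_mk, AddHom.coe_mk,
      Finset.mul_sum]
    refine Finset.sum_congr (by congr) fun v _ => ?_
    rw [edgeWeight_comm, edgeWeight_eq, linkWeight_singleton]
    simp only [skeleton_link_adj]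
    split_ifs with h
    · have e : linkWeight m τ {v.1, u.1} = m (insert u.1 (insert v.1 τ)) := by
        rw [linkWeight]; congr 1
        ext x; simp only [Finset.mem_union, Finset.mem_insert, Finset.mem_singleton]; tauto
      rw [e, hf, hf]
      field_simp
    · simp
  · intro v hv
    rw [edgeWeight_comm, edgeWeight_eq_zero_left hv, zero_mul]

/-- Extension by zero of a `0`-form to all of `V`. -/
def extendZero {K : PreAbstractSimplicialComplex V} (φ : ZeroForm K) (v : V) : ℝ :=
  open scoped Classical in if h : ({v} : Finset V) ∈ K then φ ⟨v, h⟩ else 0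

theorem extendZero_coe {V : Type u} {K : PreAbstractSimplicialComplex V} (φ : ZeroForm K)
    (u : {v : V // ({v} : Finset V) ∈ K}) : extendZero φ u.1 = φ u := by
  simp [extendZero, u.2]

/-- The Poincaré inequality with constant `a` in the link of `τ`, for functions on all of `V`. -/
def LinkPoincare (X : PreAbstractSimplicialComplex V) (m : Finset V → ℝ) (τ : Finset V) (a : ℝ) :
    Prop :=
  ∀ f : V → ℝ, a * (∑ u, vertexWeight X m τ u * f u ^ 2 -
    (∑ u, vertexWeight X m τ u * f u) ^ 2 / m τ) ≤
      1 / 2 * ∑ u, ∑ v, edgeWeight X m τ u v * (f u - f v) ^ 2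

theorem linkPoincare_of_spectrum (hX : IsPure X n) (hm : IsWeight X n m) {τ : Finset V}
    (hτ : τ ∈ simplices X τ.card) (hcard : τ.card ≤ n) (hconn : (skeleton (link X τ)).Connected)
    {a : ℝ} (h : spectrum ℝ (upperLaplacian (link X τ) (linkWeight m τ)) \ {0} ⊆ Set.Ici a) :
    LinkPoincare X m τ a := by
  classical
  intro f
  set W := {v : V // ({v} : Finset V) ∈ link X τ}
  set L := upperLaplacian (link X τ) (linkWeight m τ)
  have hsum : ∀ F : V → ℝ, ∑ u : W, vertexWeight X m τ u.1 * F u.1 =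
      ∑ u, vertexWeight X m τ u * F u := fun F =>
    sum_subtype_of_eq_zero _ (fun u => vertexWeight X m τ u * F u)
      fun u hu => by rw [vertexWeight_eq_zero hu, zero_mul]
  have hquad : ∀ (φ ψ : W → ℝ) (F G : V → ℝ), (∀ u : W, F u.1 = φ u) → (∀ u : W, G u.1 = ψ u) →
      ∑ u : W, vertexWeight X m τ u.1 * L φ u * ψ u =
        1 / 2 * ∑ u, ∑ v, edgeWeight X m τ u v * (F u - F v) * (G u - G v) := by
    intro φ ψ F G hF hG
    rw [← sum_sum_mul_sub_mul (edgeWeight_comm X m τ),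
      ← sum_subtype_of_eq_zero (fun v : V => ({v} : Finset V) ∈ link X τ)
        (fun u => ∑ v, edgeWeight X m τ u v * (F u - F v) * G u)]
    · refine Finset.sum_congr rfl fun u _ => ?_
      rw [vertexWeight_mul_upperLaplacian hX hm hF, Finset.sum_mul]
      simp only [hG]
    · intro u hu
      simp [edgeWeight_eq_zero_left hu]
  have hext : ∀ (φ : W → ℝ) (u : W), extendZero (K := link X τ) φ u.1 = φ u := extendZero_coe
  have key := weighted_poincare (W := W) (w := fun u => vertexWeight X m τ u.1) (L := L) (a := a)
    (fun u => by
      rw [vertexWeight_of_mem u.2]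
      exact hm.pos_of_mem hX (singleton_mem_link.1 u.2).2) ?_ ?_ ?_ h (fun u => f u.1)
  · rw [hquad _ _ f f (fun _ => rfl) (fun _ => rfl)] at key
    have h1 := hsum (fun u => f u ^ 2)
    have h2 := hsum f
    have h3 := hsum (fun _ => 1)
    simp only [mul_one, hm.sum_vertexWeight hcard, extWeight, if_pos (mem_simplices.1 hτ).1] at h3
    rw [h1, h2, h3] at key
    simpa only [mul_assoc, ← sq] using key
  · intro φ ψ
    rw [hquad φ ψ _ _ (hext φ) (hext ψ)]
    have : ∀ u : W, vertexWeight X m τ u.1 * φ u * L ψ u = vertexWeight X m τ u.1 * L ψ u * φ u :=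
      fun u => by ring
    simp only [this]
    rw [hquad ψ φ _ _ (hext ψ) (hext φ)]
    simp only [mul_right_comm]
  · intro φ hφ
    have h0 := hquad φ φ _ _ (hext φ) (hext φ)
    have hnn : ∀ u v, 0 ≤ edgeWeight X m τ u v * (extendZero (K := link X τ) φ u -
        extendZero (K := link X τ) φ v) * (extendZero (K := link X τ) φ u -
        extendZero (K := link X τ) φ v) := fun u v => by
      rw [mul_assoc]
      exact mul_nonneg (hm.edgeWeight_nonneg hX τ u v) (mul_self_nonneg _)
    rw [hφ] at h0
    simp only [Pi.zero_apply, mul_zero, zero_mul, Finset.sum_const_zero] at h0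
    have hadj : ∀ u v : W, (skeleton (link X τ)).Adj u v → φ u = φ v := by
      intro u v huv
      have h1 := (Finset.sum_eq_zero_iff_of_nonneg fun u _ => Finset.sum_nonneg fun v _ =>
        hnn u v).1 (by linarith) u.1 (Finset.mem_univ _)
      have h2 := (Finset.sum_eq_zero_iff_of_nonneg fun v _ => hnn u.1 v).1 h1 v.1
        (Finset.mem_univ _)
      have hadj := skeleton_link_adj.1 huv
      rw [hext, hext, edgeWeight_eq, if_pos hadj, mul_assoc] at h2
      have h3 := (mul_eq_zero.1 h2).resolve_left (hm.pos_of_mem hX hadj.2.2.2).ne'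
      exact sub_eq_zero.1 (mul_self_eq_zero.1 h3)
    intro u v
    obtain ⟨p⟩ := hconn.preconnected u v
    induction p with
    | nil => rfl
    | cons hab _ ih => exact (hadj _ _ hab).trans ih
  · ext u
    have := vertexWeight_mul_upperLaplacian hX hm (τ := τ) (φ := fun _ => 1) (f := fun _ => 1)
      (fun _ => rfl) u
    simp only [sub_self, mul_zero, Finset.sum_const_zero] at this
    refine (mul_eq_zero.1 this).resolve_left ?_
    rw [vertexWeight_of_mem u.2]
    exact (hm.pos_of_mem hX (singleton_mem_link.1 u.2).2).ne'

/-! ### Spectral gaps trickle down -/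

/-- A spectral value of the Laplacian of a link, as an eigenvalue equation for a function on `V`. -/
theorem exists_eigenfunction (hX : IsPure X n) (hm : IsWeight X n m) {τ : Finset V} {μ : ℝ}
    (hμ : μ ∈ spectrum ℝ (upperLaplacian (link X τ) (linkWeight m τ))) :
    ∃ f : V → ℝ, (∃ u, {u} ∈ link X τ ∧ f u ≠ 0) ∧
      ∀ u, ∑ v, edgeWeight X m τ u v * (f u - f v) = μ * (vertexWeight X m τ u * f u) := by
  obtain ⟨φ, hφ⟩ := (Module.End.hasEigenvalue_iff_mem_spectrum.2 hμ).exists_hasEigenvector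
  refine ⟨extendZero φ, ?_, fun u => ?_⟩
  · obtain ⟨u, hu⟩ := Function.ne_iff.1 hφ.2
    exact ⟨u.1, u.2, by rwa [extendZero_coe]⟩
  · by_cases hu : {u} ∈ link X τ
    · rw [← vertexWeight_mul_upperLaplacian hX hm (extendZero_coe φ) ⟨u, hu⟩, hφ.apply_eq_smul,
        extendZero_coe φ ⟨u, hu⟩]
      simp only [Pi.smul_apply, smul_eq_mul]
      ring
    · simp [edgeWeight_eq_zero_left hu, vertexWeight_eq_zero hu]

theorem sum_vertexWeight_mul_sq_pos (hX : IsPure X n) (hm : IsWeight X n m) {τ : Finset V}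
    {f : V → ℝ} (hf : ∃ u, {u} ∈ link X τ ∧ f u ≠ 0) :
    0 < ∑ u, vertexWeight X m τ u * f u ^ 2 := by
  obtain ⟨u, hu, hfu⟩ := hf
  refine Finset.sum_pos' (fun v _ => mul_nonneg (hm.vertexWeight_nonneg hX τ v) (sq_nonneg _))
    ⟨u, Finset.mem_univ _, ?_⟩
  rw [vertexWeight_of_mem hu]
  have := hm.pos_of_mem hX (singleton_mem_link.1 hu).2
  positivity

theorem eigenvalue_nonneg (hX : IsPure X n) (hm : IsWeight X n m) {τ : Finset V} {μ : ℝ}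
    (hμ : μ ∈ spectrum ℝ (upperLaplacian (link X τ) (linkWeight m τ))) : 0 ≤ μ := by
  obtain ⟨f, hf, heq⟩ := exists_eigenfunction hX hm hμ
  have hN := sum_vertexWeight_mul_sq_pos hX hm hf
  have hQ := sum_sum_mul_sub_mul (edgeWeight_comm X m τ) f f
  simp only [← Finset.sum_mul, heq] at hQ
  have e : ∑ u, μ * (vertexWeight X m τ u * f u) * f u =
      μ * ∑ u, vertexWeight X m τ u * f u ^ 2 := by
    rw [Finset.mul_sum]; exact Finset.sum_congr rfl fun u _ => by ring
  have h0 : 0 ≤ ∑ u, ∑ v, edgeWeight X m τ u v * (f u - f v) * (f u - f v) :=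
    Finset.sum_nonneg fun u _ => Finset.sum_nonneg fun v _ => by
      rw [mul_assoc]
      exact mul_nonneg (hm.edgeWeight_nonneg hX τ u v) (mul_self_nonneg _)
  rw [e] at hQ
  by_contra hneg
  nlinarith

/-- Garland's method: a Poincaré inequality with constant `a` in the links of all `τ ∪ {w}` forces
every nonzero eigenvalue `μ` of the link of `τ` to satisfy `a (1 - (1 - μ)²) ≤ μ`, as one sees by
summing the inequalities for an eigenfunction restricted to these links. -/
theorem spectrum_subset_of_linkPoincare (hX : IsPure X n) (hm : IsWeight X n m) {τ : Finset V}
    (hτ : τ.card + 1 < n) {a : ℝ} (ha : 0 < a)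
    (h : ∀ w, w ∉ τ → insert w τ ∈ X → LinkPoincare X m (insert w τ) a) :
    spectrum ℝ (upperLaplacian (link X τ) (linkWeight m τ)) \ {0} ⊆ Set.Ici (2 - 1 / a) := by
  classical
  rintro μ ⟨hμ, hμ0⟩
  have hμpos : 0 < μ := lt_of_le_of_ne (eigenvalue_nonneg hX hm hμ) (Ne.symm hμ0)
  obtain ⟨f, hf, heq⟩ := exists_eigenfunction hX hm hμ
  have hN := sum_vertexWeight_mul_sq_pos hX hm hf
  set N := ∑ u, vertexWeight X m τ u * f u ^ 2 with hNdef
  have hdeg := hm.sum_edgeWeight (τ := τ) (by omega)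
  -- the averaging operator acts on `f` as `1 - μ`
  have havg : ∀ w, ∑ u, edgeWeight X m τ w u * f u = (1 - μ) * (vertexWeight X m τ w * f w) := by
    intro w
    have := heq w
    simp only [mul_sub, Finset.sum_sub_distrib, ← Finset.sum_mul, hdeg] at this
    linarith
  have hQ : 1 / 2 * ∑ u, ∑ v, edgeWeight X m τ u v * (f u - f v) ^ 2 = μ * N := by
    have := sum_sum_mul_sub_mul (edgeWeight_comm X m τ) f f
    simp only [← Finset.sum_mul, heq] at this
    simp only [sq, ← mul_assoc]
    rw [← this, hNdef, Finset.mul_sum]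
    exact Finset.sum_congr rfl fun u _ => by ring
  have hlocal : ∀ w, a * (∑ u, edgeWeight X m τ w u * f u ^ 2 -
      (1 - μ) ^ 2 * (vertexWeight X m τ w * f w ^ 2)) ≤
      1 / 2 * ∑ u, ∑ v, (if w ∈ τ then 0 else edgeWeight X m (insert w τ) u v) *
        (f u - f v) ^ 2 := by
    intro w
    by_cases hw : {w} ∈ link X τ
    · have hw' := singleton_mem_link.1 hw
      have hpos := hm.pos_of_mem hX hw'.2
      have hvw : ∀ u, vertexWeight X m (insert w τ) u = edgeWeight X m τ w u := fun u => by
        rw [edgeWeight, if_neg hw'.1]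
      have := h w hw'.1 hw'.2 f
      simp only [hvw, havg, vertexWeight_of_mem hw] at this
      simp only [if_neg hw'.1, vertexWeight_of_mem hw]
      convert this using 3
      field_simp
    · simp only [edgeWeight_eq_zero_left hw, vertexWeight_eq_zero hw, zero_mul,
        Finset.sum_const_zero, mul_zero, sub_zero]
      refine mul_nonneg (by norm_num) (Finset.sum_nonneg fun u _ => Finset.sum_nonneg fun v _ => ?_)
      split_ifs
      · simp
      · exact mul_nonneg (hm.edgeWeight_nonneg hX _ u v) (sq_nonneg _)
  have hsum := Finset.sum_le_sum fun w (_ : w ∈ Finset.univ) => hlocal w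
  have hl : ∑ w, a * (∑ u, edgeWeight X m τ w u * f u ^ 2 -
      (1 - μ) ^ 2 * (vertexWeight X m τ w * f w ^ 2)) = a * (N - (1 - μ) ^ 2 * N) := by
    rw [← Finset.mul_sum, Finset.sum_sub_distrib, ← Finset.mul_sum, Finset.sum_comm]
    simp only [← Finset.sum_mul, edgeWeight_comm X m τ _, hdeg]
    rfl
  have hr : ∑ w, 1 / 2 * ∑ u, ∑ v, (if w ∈ τ then 0 else edgeWeight X m (insert w τ) u v) *
      (f u - f v) ^ 2 = μ * N := by
    rw [← hQ, ← Finset.mul_sum, Finset.sum_comm]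
    congr 1
    refine Finset.sum_congr rfl fun u _ => ?_
    rw [Finset.sum_comm]
    refine Finset.sum_congr rfl fun v _ => ?_
    rw [← Finset.sum_mul, hm.sum_edgeWeight_insert hτ]
  rw [hl, hr] at hsum
  have h1 : a * (2 - μ) * (μ * N) ≤ 1 * (μ * N) := by linarith
  have h2 : a * (2 - μ) ≤ 1 := le_of_mul_le_mul_right h1 (by positivity)
  rw [Set.mem_Ici, sub_le_comm, le_div_iff₀ ha]
  linarith

/-- The spectral gap in the links of simplices with `n - 1 - i` vertices which follows from a gap
of `lam` in the links of simplices with `n - 1` vertices: the `i`-th iterate of `a ↦ 2 - 1 / a`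
at `lam`. -/
def trickledGap (i : ℕ) (lam : ℝ) : ℝ :=
  (1 - (i + 1) * (1 - lam)) / (1 - i * (1 - lam))

theorem one_sub_mul_pos {n : ℕ} {lam : ℝ} (hlam : ((n : ℝ) - 1) / n < lam) {i : ℕ} (hi : i ≤ n) :
    0 < 1 - i * (1 - lam) := by
  rcases Nat.eq_zero_or_pos n with rfl | hn
  · obtain rfl : i = 0 := by omega
    simp
  have hn' : (0 : ℝ) < n := by exact_mod_cast hn
  rw [div_lt_iff₀ hn'] at hlam
  have hi' : (i : ℝ) ≤ n := by exact_mod_cast hi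
  rcases le_or_gt lam 1 with h | h
  · nlinarith
  · nlinarith [(Nat.cast_nonneg i : (0 : ℝ) ≤ i)]

theorem linkSpectrumGE_trickledGap (hX : IsPure X n) (hm : IsWeight X n m)
    (hconn : LinksConnected X n) {lam : ℝ} (hlam : ((n : ℝ) - 1) / n < lam)
    (h : LinkSpectrumGE X m (n - 1) lam) {i : ℕ} (hi : i < n) :
    LinkSpectrumGE X m (n - 1 - i) (trickledGap i lam) := by
  induction i with
  | zero => simpa [trickledGap] using h
  | succ i ih =>
    intro τ hτ
    have hτc := (mem_simplices.1 hτ).2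
    have p0 := one_sub_mul_pos hlam (i := i) (by omega)
    have p1 := one_sub_mul_pos hlam (i := i + 1) (by omega)
    push_cast at p1
    have hstep : trickledGap (i + 1) lam = 2 - 1 / trickledGap i lam := by
      unfold trickledGap
      push_cast
      field_simp
      ring
    rw [hstep]
    refine spectrum_subset_of_linkPoincare hX hm (by omega) (div_pos p1 p0) fun w hw hwX => ?_
    have hc : (insert w τ).card = n - 1 - i := by
      rw [Finset.card_insert_of_notMem hw]; omega
    have hs : insert w τ ∈ simplices X (n - 1 - i) := mem_simplices.2 ⟨Or.inr hwX, hc⟩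
    exact linkPoincare_of_spectrum hX hm (hc ▸ hs) (by omega)
      (hconn (n - 1 - i) (by omega) _ hs) (ih (by omega) _ hs)

end

noncomputable section

variable {V : Type u} [Fintype V] [DecidableEq V] {X Y : PreAbstractSimplicialComplex V} {n k : ℕ}
  {m : Finset V → ℝ}

/-! ### The inner connectivity constant -/

open scoped Classical in
/-- The total conductance of the edges of `H` which join `v` to `w` in `G`. -/
def linkConductance {α β : Type u} [Fintype β] (H G : Graph α β) (c : β → ℝ) (v w : α) : ℝ :=
  ∑ e, if e ∈ H.edgeSet ∧ G.IsLink e v w then c e else 0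

theorem linkConductance_comm {α β : Type u} [Fintype β] (H G : Graph α β) (c : β → ℝ) (v w : α) :
    linkConductance H G c v w = linkConductance H G c w v := by
  classical
  unfold linkConductance
  simp only [G.isLink_comm (x := v)]

theorem nu_eq_sum_linkConductance {α β : Type u} [Fintype α] [Fintype β] (G : Graph α β)
    (c : β → ℝ) (v : α) : nu G c v = ∑ w, linkConductance G G c v w := by
  classical
  unfold nu linkConductance
  rw [Finset.sum_filter, Finset.sum_comm]
  refine Finset.sum_congr rfl fun e _ => ?_
  split_ifs with h
  · obtain ⟨w, hw⟩ := h
    rw [Finset.sum_eq_single w, if_pos ⟨hw.edge_mem, hw⟩]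
    · exact fun w' _ hne => if_neg fun h' => hne (h'.2.right_unique hw)
    · simp
  · exact (Finset.sum_eq_zero fun w _ => if_neg fun h' => h ⟨w, h'.2⟩).symm

theorem pathMu_cons {α β : Type u} [Fintype α] [Fintype β] (H G : Graph α β) (c : β → ℝ) (v : α)
    (L : List (Set β)) :
    pathMu G c v (H.edgeSet :: L) =
      (∑ w, linkConductance H G c v w * pathMu G c w L) / nu G c v := by
  classical
  rw [pathMu, Finset.sum_comm, Finset.sum_div]
  refine Finset.sum_congr rfl fun w _ => ?_
  rw [linkConductance, Finset.sum_mul, Finset.sum_div]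
  refine Finset.sum_congr rfl fun e _ => ?_
  split_ifs <;> ring

open scoped Classical in
/-- By reversibility of the walk, two steps inside `H` amount to the squares of the degrees of the
midpoints. -/
theorem hInnerGraph_eq {α β : Type u} [Fintype α] [Fintype β] {H G : Graph α β} {c : β → ℝ}
    (hE : H.edgeSet ≠ ∅) (hν : ∀ v ∈ H.vertexSet, nu G c v ≠ 0)
    (hH : ∀ v w, v ∉ H.vertexSet → linkConductance H G c v w = 0) :
    hInnerGraph H G c =
      (∑ v with v ∈ H.vertexSet, (∑ w, linkConductance H G c v w) ^ 2 / nu G c v) /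
        ∑ v with v ∈ H.vertexSet, ∑ w, linkConductance H G c v w := by
  rw [hInnerGraph, if_neg hE, pathC, pathC]
  have h1 : ∀ v, pathMu G c v [H.edgeSet] = (∑ w, linkConductance H G c v w) / nu G c v :=
    fun v => by rw [pathMu_cons]; simp [pathMu]
  congr 1
  · have h2 : ∀ v ∈ Finset.univ.filter (· ∈ H.vertexSet),
        nu G c v * pathMu G c v [H.edgeSet, H.edgeSet] =
        ∑ w, linkConductance H G c v w * ((∑ z, linkConductance H G c w z) / nu G c w) := by
      intro v hv
      rw [pathMu_cons, mul_div_cancel₀ _ (hν v (Finset.mem_filter.1 hv).2)]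
      simp only [h1]
    rw [Finset.sum_congr rfl h2, Finset.sum_filter_of_ne, Finset.sum_comm, Finset.sum_filter_of_ne]
    · refine Finset.sum_congr rfl fun w _ => ?_
      rw [← Finset.sum_mul]
      simp only [linkConductance_comm H G c _ w]
      ring
    · intro v _ hne
      by_contra hv
      exact hne (by simp [hH v _ hv])
    · intro v _ hne
      by_contra hv
      exact hne (by simp [hH v _ hv])
  · refine Finset.sum_congr rfl fun v hv => ?_
    rw [h1, mul_div_cancel₀ _ (hν v (Finset.mem_filter.1 hv).2)]

theorem isLink_simplexGraph_of_mem {V : Type u} [Fintype V] {X Y : PreAbstractSimplicialComplex V}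
    {k : ℕ} (hYX : ∀ s ∈ Y, s ∈ X) {e : Finset V × Sym2 (Finset V)}
    {v w : Finset V} :
    (e ∈ (simplexGraph Y k).edgeSet ∧ (simplexGraph X k).IsLink e v w) ↔
      e.2 = s(v, w) ∧ e.1 ∈ simplices Y (k + 1) ∧ v ⊆ e.1 ∧ w ⊆ e.1 ∧ v.card = k ∧ w.card = k ∧
        (k = 0 ∨ v ≠ w) := by
  constructor
  · rintro ⟨⟨a, b, h1, h2, -⟩, g1, g2, g3, g4, g5, g6, g7⟩
    exact ⟨g1, h2, g5, g6, (mem_simplices.1 g3).2, (mem_simplices.1 g4).2, g7⟩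
  · rintro ⟨g1, g2, g3, g4, g5, g6, g7⟩
    have hv := mem_simplices_of_subset g2 g3
    have hw := mem_simplices_of_subset g2 g4
    have hmono : ∀ {j s}, s ∈ simplices Y j → s ∈ simplices X j := fun hs =>
      mem_simplices.2 ⟨(mem_simplices.1 hs).1.imp id (hYX _), (mem_simplices.1 hs).2⟩
    rw [g5] at hv
    rw [g6] at hw
    exact ⟨⟨v, w, g1, g2, hv, hw, g3, g4, g7⟩, g1, hmono g2, hmono hv, hmono hw, g3, g4, g7⟩

open scoped Classical in
theorem linkConductance_simplexGraph (hYX : ∀ s ∈ Y, s ∈ X) (m : Finset V → ℝ) (v w : Finset V) :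
    linkConductance (simplexGraph Y k) (simplexGraph X k) (simplexConductance m) v w =
      ∑ σ ∈ simplices Y (k + 1), if v ⊆ σ ∧ w ⊆ σ ∧ v.card = k ∧ w.card = k ∧ (k = 0 ∨ v ≠ w)
        then m σ else 0 := by
  unfold linkConductance simplexConductance
  simp only [isLink_simplexGraph_of_mem hYX]
  rw [Fintype.sum_prod_type, ← Finset.sum_subset (Finset.subset_univ (simplices Y (k + 1)))]
  · refine Finset.sum_congr rfl fun σ hσ => ?_
    simp only [hσ, true_and, ite_and]
    rw [Finset.sum_ite_eq']
    simp
  · intro σ _ hσ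
    simp [hσ]

/-- The number of edges of `X_{k-1}` inside a given `k`-simplex at a given one of its facets. -/
def facetDegree (k : ℕ) : ℝ := if k = 0 then 1 else k

theorem facetDegree_pos (k : ℕ) : 0 < facetDegree k := by
  unfold facetDegree
  split_ifs with h
  · exact one_pos
  · exact_mod_cast Nat.pos_of_ne_zero h

theorem sum_linkConductance_simplexGraph (hYX : ∀ s ∈ Y, s ∈ X) (m : Finset V → ℝ) {v : Finset V}
    (hv : v.card = k) :
    ∑ w, linkConductance (simplexGraph Y k) (simplexGraph X k) (simplexConductance m) v w =
      facetDegree k * ∑ u, vertexWeight Y m v u := by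
  classical
  simp only [linkConductance_simplexGraph hYX]
  rw [Finset.sum_comm, ← sum_simplices_superset Y m hv, Finset.sum_filter, Finset.mul_sum]
  refine Finset.sum_congr rfl fun σ hσ => ?_
  by_cases hvσ : v ⊆ σ
  · have hcard : ((Finset.univ.filter fun w : Finset V =>
        w ⊆ σ ∧ w.card = k ∧ (k = 0 ∨ v ≠ w)).card : ℝ) = facetDegree k := by
      have hσc := (mem_simplices.1 hσ).2
      unfold facetDegree
      split_ifs with h0
      · have : (Finset.univ.filter fun w : Finset V => w ⊆ σ ∧ w.card = k ∧ (k = 0 ∨ v ≠ w)) =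
            {∅} := by
          ext w
          simp only [h0, Finset.mem_filter, Finset.mem_univ, true_and, true_or, and_true,
            Finset.card_eq_zero, Finset.mem_singleton]
          exact ⟨fun h => h.2, fun h => by simp [h]⟩
        simp [this]
      · have : (Finset.univ.filter fun w : Finset V => w ⊆ σ ∧ w.card = k ∧ (k = 0 ∨ v ≠ w)) =
            (σ.powersetCard k).erase v := by
          ext w
          simp only [h0, Finset.mem_filter, Finset.mem_univ, true_and, false_or,
            Finset.mem_erase, Finset.mem_powersetCard]
          tauto
        rw [this, Finset.card_erase_of_mem (Finset.mem_powersetCard.2 ⟨hvσ, hv⟩),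
          Finset.card_powersetCard, hσc, Nat.choose_succ_self_right]
        simp
    simp only [hvσ, hv, true_and, if_true]
    rw [← Finset.sum_filter, Finset.sum_const, nsmul_eq_mul, hcard]
  · simp [hvσ]

/-- Summing over the pairs of a simplex with `k` vertices and a vertex of its link is summing over
the pairs of a simplex with `k + 1` vertices and one of its vertices. -/
theorem sum_sum_vertexWeight_mul (Y : PreAbstractSimplicialComplex V) (m : Finset V → ℝ) (k : ℕ)
    (F : Finset V → V → ℝ) :
    ∑ τ ∈ simplices Y k, ∑ u, vertexWeight Y m τ u * F τ u =
      ∑ σ ∈ simplices Y (k + 1), ∑ u ∈ σ, m σ * F (σ.erase u) u := by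
  classical
  simp only [vertexWeight_eq, ite_mul, zero_mul]
  simp only [← Finset.sum_filter]
  rw [Finset.sum_sigma', Finset.sum_sigma']
  refine Finset.sum_bij' (fun p _ => ⟨insert p.2 p.1, p.2⟩) (fun p _ => ⟨p.1.erase p.2, p.2⟩)
    ?_ ?_ ?_ ?_ ?_
  · rintro ⟨τ, u⟩ h
    simp only [Finset.mem_sigma, Finset.mem_filter, Finset.mem_univ, true_and] at h
    simp only [Finset.mem_sigma, Finset.mem_insert_self, and_true]
    exact mem_simplices.2 ⟨Or.inr h.2.2, by
      rw [Finset.card_insert_of_notMem h.2.1, (mem_simplices.1 h.1).2]⟩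
  · rintro ⟨σ, u⟩ h
    simp only [Finset.mem_sigma] at h
    simp only [Finset.mem_sigma, Finset.mem_filter, Finset.mem_univ, true_and,
      Finset.notMem_erase, not_false_eq_true, Finset.insert_erase h.2]
    have := mem_simplices_of_subset h.1 (Finset.erase_subset u σ)
    rw [Finset.card_erase_of_mem h.2, (mem_simplices.1 h.1).2] at this
    exact ⟨this, mem_of_mem_simplices_succ h.1⟩
  · rintro ⟨τ, u⟩ h
    simp only [Finset.mem_sigma, Finset.mem_filter, Finset.mem_univ, true_and] at h
    simp [h.2.1]
  · rintro ⟨σ, u⟩ h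
    simp only [Finset.mem_sigma] at h
    simp [Finset.insert_erase h.2]
  · rintro ⟨τ, u⟩ h
    simp only [Finset.mem_sigma, Finset.mem_filter, Finset.mem_univ, true_and] at h
    simp [h.2.1]

theorem sum_sum_vertexWeight (Y : PreAbstractSimplicialComplex V) (m : Finset V → ℝ) (k : ℕ) :
    ∑ τ ∈ simplices Y k, ∑ u, vertexWeight Y m τ u =
      (k + 1) * ∑ σ ∈ simplices Y (k + 1), m σ := by
  have := sum_sum_vertexWeight_mul Y m k (fun _ _ => 1)
  simp only [mul_one] at this
  rw [this, Finset.mul_sum]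
  refine Finset.sum_congr rfl fun σ hσ => ?_
  rw [Finset.sum_const, (mem_simplices.1 hσ).2]
  simp

theorem spanned_subset {V : Type u} {X : PreAbstractSimplicialComplex V} {l : ℕ}
    (U : Fin l → Finset V) : ∀ s ∈ spanned X U, s ∈ X :=
  fun _ h => h.1

theorem simplices_subset {V : Type u} [Fintype V] {X Y : PreAbstractSimplicialComplex V}
    (hYX : ∀ s ∈ Y, s ∈ X) {j : ℕ} {s : Finset V} (hs : s ∈ simplices Y j) :
    s ∈ simplices X j :=
  mem_simplices.2 ⟨(mem_simplices.1 hs).1.imp id (hYX _), (mem_simplices.1 hs).2⟩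

theorem mem_vertexSet_simplexGraph {V : Type u} [Fintype V]
    {Y : PreAbstractSimplicialComplex V} {k : ℕ} {v : Finset V} :
    v ∈ (simplexGraph Y k).vertexSet ↔ v ∈ simplices Y k := Iff.rfl

theorem hInner_eq (hX : IsPure X n) (hm : IsWeight X n m) (hk : k < n) {U : Fin (k + 1) → Finset V}
    (hU : setWeight X m U ≠ 0) :
    hInner X m k U =
      (∑ τ ∈ simplices (spanned X U) k, (∑ u, vertexWeight (spanned X U) m τ u) ^ 2 / m τ) /
        ((k + 1) * setWeight X m U) := by
  classical
  have hYX := spanned_subset (X := X) U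
  set Y := spanned X U with hY
  have hκ := facetDegree_pos k
  have hνeq : ∀ v ∈ simplices Y k, nu (simplexGraph X k) (simplexConductance m) v =
      facetDegree k * m v := by
    intro v hv
    have hvX := mem_simplices.1 (simplices_subset hYX hv)
    rw [nu_eq_sum_linkConductance, sum_linkConductance_simplexGraph (fun _ h => h) m hvX.2,
      hm.sum_vertexWeight (by omega), extWeight, if_pos hvX.1]
  have hmpos : ∀ v ∈ simplices Y k, 0 < m v := fun v hv => hm.pos hX (simplices_subset hYX hv)
  have hvert : Finset.univ.filter (· ∈ (simplexGraph Y k).vertexSet) = simplices Y k := by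
    ext τ; simp [mem_vertexSet_simplexGraph]
  rw [hInner, hInnerGraph_eq, hvert]
  · have h1 : ∀ v ∈ simplices Y k, (∑ w, linkConductance (simplexGraph Y k) (simplexGraph X k)
        (simplexConductance m) v w) ^ 2 / nu (simplexGraph X k) (simplexConductance m) v =
        facetDegree k * ((∑ u, vertexWeight Y m v u) ^ 2 / m v) := by
      intro v hv
      rw [sum_linkConductance_simplexGraph hYX m (mem_simplices.1 hv).2, hνeq v hv]
      field_simp
    have h2 : ∀ v ∈ simplices Y k, ∑ w, linkConductance (simplexGraph Y k) (simplexGraph X k)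
        (simplexConductance m) v w = facetDegree k * ∑ u, vertexWeight Y m v u :=
      fun v hv => sum_linkConductance_simplexGraph hYX m (mem_simplices.1 hv).2
    rw [Finset.sum_congr rfl h1, Finset.sum_congr rfl h2, ← Finset.mul_sum, ← Finset.mul_sum,
      sum_sum_vertexWeight, mul_div_mul_left _ _ hκ.ne']
    rfl
  · obtain ⟨σ, hσ, -⟩ := Finset.exists_ne_zero_of_sum_ne_zero hU
    have hc := (mem_simplices.1 hσ).2
    -- for `k ≥ 1` the simplex `σ` has two distinct facets; for `k = 0` the loop at `∅` is used
    obtain ⟨v, hv, w, hw, hvw⟩ : ∃ v ∈ σ.powersetCard k, ∃ w ∈ σ.powersetCard k,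
        k = 0 ∨ v ≠ w := by
      rcases Nat.eq_zero_or_pos k with h0 | h0
      · exact ⟨∅, by simp [h0], ∅, by simp [h0], Or.inl h0⟩
      · obtain ⟨a, ha, b, hb, hab⟩ := Finset.one_lt_card.1 (show 1 < (σ.powersetCard k).card by
          rw [Finset.card_powersetCard, hc, Nat.choose_succ_self_right]; omega)
        exact ⟨a, ha, b, hb, Or.inr hab⟩
    rw [Finset.mem_powersetCard] at hv hw
    have hmem : (σ, s(v, w)) ∈ (simplexGraph Y k).edgeSet :=
      ((isLink_simplexGraph_of_mem hYX).2 ⟨rfl, hσ, hv.1, hw.1, hv.2, hw.2, hvw⟩).1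
    exact Set.Nonempty.ne_empty ⟨_, hmem⟩
  · intro v hv
    rw [mem_vertexSet_simplexGraph] at hv
    rw [hνeq v hv]
    exact (mul_pos hκ (hmpos v hv)).ne'
  · intro v w hv
    rw [linkConductance_simplexGraph hYX]
    refine Finset.sum_eq_zero fun σ hσ => if_neg ?_
    rintro ⟨h1, -, h2, -⟩
    rw [mem_vertexSet_simplexGraph] at hv
    have h3 := mem_simplices_of_subset hσ h1
    rw [h2] at h3
    exact hv h3

theorem setWeight_nonneg (hX : IsPure X n) (hm : IsWeight X n m) {l : ℕ} (U : Fin l → Finset V) :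
    0 ≤ setWeight X m U :=
  Finset.sum_nonneg fun _ hτ => (hm.pos hX (simplices_subset (spanned_subset U) hτ)).le

theorem vertexWeight_le (hX : IsPure X n) (hm : IsWeight X n m) (hYX : ∀ s ∈ Y, s ∈ X)
    (τ : Finset V) (u : V) : vertexWeight Y m τ u ≤ vertexWeight X m τ u := by
  classical
  rw [vertexWeight_eq, vertexWeight_eq]
  by_cases h : u ∉ τ ∧ insert u τ ∈ Y
  · rw [if_pos h, if_pos ⟨h.1, hYX _ h.2⟩]
  · rw [if_neg h]
    split_ifs with h'
    · exact (hm.pos_of_mem hX h'.2).le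
    · exact le_rfl

theorem vertexWeight_nonneg_of_subset (hX : IsPure X n) (hm : IsWeight X n m)
    (hYX : ∀ s ∈ Y, s ∈ X) (τ : Finset V) (u : V) : 0 ≤ vertexWeight Y m τ u := by
  classical
  rw [vertexWeight_eq]
  split_ifs with h
  · exact (hm.pos_of_mem hX (hYX _ h.2)).le
  · exact le_rfl

/-! ### The Cheeger inequality -/

/-- Adding to a `k`-simplex spanned by `U_0, …, U_k` a vertex `v` of some `U_j` and removing the
vertex in the same `U_j` gives another simplex spanned by the `U_i`. -/
theorem exists_insert_erase_mem_spanned {V : Type u} [DecidableEq V]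
    {X : PreAbstractSimplicialComplex V} {l : ℕ} {U : Fin l → Finset V} {σ : Finset V}
    (hσ : σ ∈ spanned X U) (hc : σ.card = l) {v : V} (hv : v ∈ Finset.univ.biUnion U)
    (hvσ : v ∉ σ) (hins : insert v σ ∈ X) : ∃ u ∈ σ, insert v (σ.erase u) ∈ spanned X U := by
  obtain ⟨hσX, f, hf, hfU⟩ := hσ
  obtain ⟨j, -, hj⟩ := Finset.mem_biUnion.1 hv
  have hsurj : σ.image f = Finset.univ :=
    Finset.eq_univ_of_card _ (by rw [Finset.card_image_of_injOn hf, hc, Fintype.card_fin])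
  obtain ⟨u, hu, rfl⟩ := Finset.mem_image.1 (hsurj ▸ Finset.mem_univ j)
  refine ⟨u, hu, mem_of_subset hins (Finset.insert_subset_insert _ (Finset.erase_subset _ _))
    (Finset.insert_nonempty _ _), Function.update f v (f u), ?_, ?_⟩
  · have hne : ∀ x ∈ σ.erase u, x ≠ v := by
      rintro x hx rfl; exact hvσ (Finset.mem_of_mem_erase hx)
    have hfne : ∀ x ∈ σ.erase u, f x ≠ f u := fun x hx h =>
      Finset.ne_of_mem_erase hx (hf (Finset.mem_of_mem_erase hx) hu h)
    intro x hx y hy hxy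
    rw [Finset.mem_coe, Finset.mem_insert] at hx hy
    rcases hx with rfl | hx <;> rcases hy with rfl | hy
    · rfl
    · rw [Function.update_self, Function.update_of_ne (hne y hy)] at hxy
      exact absurd hxy.symm (hfne y hy)
    · rw [Function.update_self, Function.update_of_ne (hne x hx)] at hxy
      exact absurd hxy (hfne x hx)
    · rw [Function.update_of_ne (hne x hx), Function.update_of_ne (hne y hy)] at hxy
      exact hf (Finset.mem_of_mem_erase hx) (Finset.mem_of_mem_erase hy) hxy
  · intro x hx
    by_cases hxv : x = v
    · rw [hxv, Function.update_self]; exact hj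
    · rw [Function.update_of_ne hxv]
      exact hfU x (Finset.mem_of_mem_erase ((Finset.mem_insert.1 hx).resolve_left hxv))

theorem subset_biUnion_of_mem_spanned {V : Type u} [DecidableEq V]
    {X : PreAbstractSimplicialComplex V} {l : ℕ} {U : Fin l → Finset V} {σ : Finset V}
    (hσ : σ ∈ spanned X U) : σ ⊆ Finset.univ.biUnion U := by
  obtain ⟨-, f, -, hf⟩ := hσ
  exact fun v hv => Finset.mem_biUnion.2 ⟨f v, Finset.mem_univ _, hf v hv⟩

theorem insert_mem_spanned_snoc {V : Type u} [DecidableEq V]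
    {X : PreAbstractSimplicialComplex V} {l : ℕ} {U : Fin l → Finset V} {W σ : Finset V}
    (hσ : σ ∈ spanned X U) {v : V} (hv : v ∈ W) (hvσ : v ∉ σ) (hins : insert v σ ∈ X) :
    insert v σ ∈ spanned X (Fin.snoc (α := fun _ => Finset V) U W) := by
  obtain ⟨hσX, f, hf, hfU⟩ := hσ
  refine ⟨hins, Function.update (fun x => (f x).castSucc) v (Fin.last l), ?_, ?_⟩
  · have hne : ∀ x ∈ σ, x ≠ v := by
      rintro x hx rfl; exact hvσ hx
    intro x hx y hy hxy
    rw [Finset.mem_coe, Finset.mem_insert] at hx hy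
    rcases hx with rfl | hx <;> rcases hy with rfl | hy
    · rfl
    · rw [Function.update_self, Function.update_of_ne (hne y hy)] at hxy
      exact absurd hxy.symm (Fin.castSucc_lt_last _).ne
    · rw [Function.update_self, Function.update_of_ne (hne x hx)] at hxy
      exact absurd hxy (Fin.castSucc_lt_last _).ne
    · rw [Function.update_of_ne (hne x hx), Function.update_of_ne (hne y hy)] at hxy
      exact hf hx hy (Fin.castSucc_injective l hxy)
  · intro x hx
    by_cases hxv : x = v
    · rw [hxv, Function.update_self, Fin.snoc_last]; exact hv
    · rw [Function.update_of_ne hxv, Fin.snoc_castSucc]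
      exact hfU x ((Finset.mem_insert.1 hx).resolve_left hxv)

theorem hOut_eq (X : PreAbstractSimplicialComplex V) (m : Finset V → ℝ)
    (U : Fin (k + 1) → Finset V) :
    hOut X m k U = if vertexSet X \ Finset.univ.biUnion U = ∅ then 0
      else setWeight X m (Fin.snoc (α := fun _ => Finset V) U
        (vertexSet X \ Finset.univ.biUnion U)) / setWeight X m U := by
  unfold hOut
  congr!

/-- The total weight of the pairs of a `k`-simplex spanned by the `U_i` and a vertex of its link
outside all `U_i` is at most `m(U_0, …, U_k, W)`. -/
theorem sum_outer_le_hOut (hX : IsPure X n) (hm : IsWeight X n m) {U : Fin (k + 1) → Finset V}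
    (hU : setWeight X m U ≠ 0) :
    ∑ σ ∈ simplices (spanned X U) (k + 1), ∑ v,
      (if v ∈ Finset.univ.biUnion U then 0 else vertexWeight X m σ v) ≤
        hOut X m k U * setWeight X m U := by
  classical
  rw [hOut_eq]
  set S := simplices (spanned X U) (k + 1)
  set B := Finset.univ.biUnion U
  set W := vertexSet X \ B with hW
  have hvW : ∀ σ v, v ∉ B → v ∉ σ → insert v σ ∈ X → v ∈ W := fun σ v h1 _ h3 => by
    simp only [hW, Finset.mem_sdiff, vertexSet, Finset.mem_filter, Finset.mem_univ, true_and]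
    exact ⟨mem_of_subset h3 (by simp) (Finset.singleton_nonempty v), h1⟩
  by_cases hW0 : W = ∅
  · rw [if_pos hW0, zero_mul]
    refine le_of_eq (Finset.sum_eq_zero fun σ _ => Finset.sum_eq_zero fun v _ => ?_)
    split_ifs with h
    · rfl
    · rw [vertexWeight_eq, if_neg]
      intro h'
      simpa [hW0] using hvW σ v h h'.1 h'.2
  · rw [if_neg hW0, div_mul_cancel₀ _ hU, setWeight]
    have e : ∀ σ v, (if v ∈ B then 0 else vertexWeight X m σ v) =
        if v ∉ B ∧ v ∉ σ ∧ insert v σ ∈ X then m (insert v σ) else 0 := fun σ v => by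
      rw [vertexWeight_eq]; by_cases h : v ∈ B <;> simp [h]
    simp only [e]
    simp only [← Finset.sum_filter]
    rw [Finset.sum_sigma']
    have hinj : Set.InjOn (fun p : (_ : Finset V) × V => insert p.2 p.1)
        (S.sigma fun σ => Finset.univ.filter fun v => v ∉ B ∧ v ∉ σ ∧ insert v σ ∈ X :
          Finset ((_ : Finset V) × V)) := by
      rintro ⟨σ, v⟩ h ⟨σ', v'⟩ h' heq
      simp only [Finset.coe_sigma, Set.mem_sigma_iff, Finset.mem_coe, Finset.mem_filter,
        Finset.mem_univ, true_and] at h h' heq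
      have hσ := subset_biUnion_of_mem_spanned (mem_of_mem_simplices_succ h.1)
      have hσ' := subset_biUnion_of_mem_spanned (mem_of_mem_simplices_succ h'.1)
      have hvv : v = v' := by
        have : v ∈ insert v' σ' := heq ▸ Finset.mem_insert_self v σ
        exact (Finset.mem_insert.1 this).resolve_right fun hmem => h.2.1 (hσ' hmem)
      subst hvv
      have : σ = σ' := by
        rw [← Finset.erase_insert h.2.2.1, heq, Finset.erase_insert h'.2.2.1]
      rw [this]
    rw [← Finset.sum_image (f := m) (g := fun p : (_ : Finset V) × V => insert p.2 p.1) hinj]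
    refine Finset.sum_le_sum_of_subset_of_nonneg ?_ fun η hη _ =>
      (hm.pos hX (simplices_subset (spanned_subset _) hη)).le
    intro η hη
    obtain ⟨⟨σ, v⟩, h, rfl⟩ := Finset.mem_image.1 hη
    simp only [Finset.mem_sigma, Finset.mem_filter, Finset.mem_univ, true_and] at h
    refine mem_simplices.2 ⟨Or.inr (insert_mem_spanned_snoc (mem_of_mem_simplices_succ h.1)
      (hvW σ v h.2.1 h.2.2.1 h.2.2.2) h.2.2.1 h.2.2.2), ?_⟩
    rw [Finset.card_insert_of_notMem h.2.2.1, (mem_simplices.1 h.1).2]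

/-- The Dirichlet energy of an indicator function is the weight of the cut. -/
theorem half_sum_indicator {α : Type*} [Fintype α] {e : α → α → ℝ} (he : ∀ u v, e u v = e v u)
    {f : α → ℝ} (hf : ∀ u, f u = 0 ∨ f u = 1) :
    1 / 2 * ∑ u, ∑ v, e u v * (f u - f v) ^ 2 = ∑ u, ∑ v, e u v * (f u * (1 - f v)) := by
  have h : ∀ u v, e u v * (f u - f v) ^ 2 =
      e u v * (f u * (1 - f v)) + e v u * (f v * (1 - f u)) := fun u v => by
    rw [he v u]
    rcases hf u with h | h <;> rcases hf v with h' | h' <;> rw [h, h'] <;> ring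
  simp only [h, Finset.sum_add_distrib]
  rw [Finset.sum_comm (f := fun u v => e v u * (f v * (1 - f u)))]
  ring

/-- The Cheeger inequality.  It is the sum, over the `(k-1)`-simplices `τ` of `X(U_0, …, U_k)`, of
the Poincaré inequalities for the indicator functions of the vertices `u` of `X_τ` for which
`τ ∪ {u}` lies in `X(U_0, …, U_k)`. -/
theorem cheeger_inequality (hX : IsPure X n) (hm : IsWeight X n m) (hk : k < n) {a : ℝ}
    (h : ∀ τ ∈ simplices X k, LinkPoincare X m τ a) {U : Fin (k + 1) → Finset V}
    (hU : setWeight X m U ≠ 0) :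
    a * (1 - hInner X m k U) ≤ k / (k + 1) + 1 / (k + 1) * hOut X m k U := by
  classical
  have hYX := spanned_subset (X := X) U
  have hM : 0 < setWeight X m U := lt_of_le_of_ne (setWeight_nonneg hX hm U) (Ne.symm hU)
  have hin := hInner_eq hX hm hk hU
  have hout := sum_outer_le_hOut hX hm hU
  have hMdef : setWeight X m U = ∑ σ ∈ simplices (spanned X U) (k + 1), m σ := rfl
  set Y := spanned X U with hY
  set M := setWeight X m U
  set d : Finset V → ℝ := fun τ => ∑ u, vertexWeight Y m τ u with hd
  -- For weights `1` the vertex weight in `Y` is the indicator of `τ ∪ {u} ∈ Y`.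
  set f : Finset V → V → ℝ := vertexWeight Y fun _ => 1 with hf
  have hfeq : ∀ τ u, f τ u = if u ∉ τ ∧ insert u τ ∈ Y then 1 else 0 := vertexWeight_eq Y _
  have hf01 : ∀ τ u, f τ u = 0 ∨ f τ u = 1 := fun τ u => by
    rw [hfeq]; split_ifs <;> simp
  have hfY : ∀ τ u, vertexWeight X m τ u * f τ u = vertexWeight Y m τ u := fun τ u => by
    rw [hfeq, vertexWeight_eq, vertexWeight_eq]
    by_cases hc : u ∉ τ ∧ insert u τ ∈ Y
    · simp [hc, hYX _ hc.2]
    · simp [hc]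
  have hlocal : ∀ τ ∈ simplices Y k, a * (d τ - d τ ^ 2 / m τ) ≤
      ∑ u, f τ u * ∑ v, vertexWeight X m (insert u τ) v * (1 - f τ v) := by
    intro τ hτ
    have h1 := h τ (simplices_subset hYX hτ) (f τ)
    have hsq : ∀ u, f τ u ^ 2 = f τ u := fun u => by rcases hf01 τ u with h | h <;> simp [h]
    rw [half_sum_indicator (edgeWeight_comm X m τ) (hf01 τ)] at h1
    simp only [hsq, hfY] at h1
    refine h1.trans (le_of_eq (Finset.sum_congr rfl fun u _ => ?_))
    rw [Finset.mul_sum]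
    refine Finset.sum_congr rfl fun v _ => ?_
    by_cases hu : u ∈ τ
    · simp [hfeq, hu]
    · rw [edgeWeight, if_neg hu]; ring
  -- a vertex `v` is cut off from all `k + 1` facets of `σ` if it lies outside the `U_i`; otherwise
  -- removing the vertex of `σ` in the same `U_i` leaves a facet `τ` with `τ ∪ {v} ∈ Y`
  have hcut : ∀ σ ∈ simplices Y (k + 1),
      ∑ u ∈ σ, 1 * ∑ v, vertexWeight X m (insert u (σ.erase u)) v * (1 - f (σ.erase u) v) ≤
        k * m σ + ∑ v, (if v ∈ Finset.univ.biUnion U then 0 else vertexWeight X m σ v) := by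
    intro σ hσ
    have hσX := simplices_subset hYX hσ
    have hσc := (mem_simplices.1 hσ).2
    have hmσ : m σ = ∑ v, vertexWeight X m σ v := by
      rw [hm.sum_vertexWeight (by omega), extWeight, if_pos (mem_simplices.1 hσX).1]
    rw [hmσ, Finset.mul_sum, ← Finset.sum_add_distrib]
    have e : ∀ u ∈ σ, 1 * ∑ v, vertexWeight X m (insert u (σ.erase u)) v *
        (1 - f (σ.erase u) v) = ∑ v, vertexWeight X m σ v * (1 - f (σ.erase u) v) :=
      fun u hu => by rw [Finset.insert_erase hu, one_mul]
    rw [Finset.sum_congr rfl e, Finset.sum_comm]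
    refine Finset.sum_le_sum fun v _ => ?_
    rw [← Finset.mul_sum, Finset.sum_sub_distrib, Finset.sum_const, hσc]
    have hw := hm.vertexWeight_nonneg hX σ v
    have hfnn : ∀ u ∈ σ, 0 ≤ f (σ.erase u) v := fun u _ => by
      rcases hf01 (σ.erase u) v with h | h <;> simp [h]
    have hs0 := Finset.sum_nonneg hfnn
    simp only [nsmul_eq_mul, mul_one]
    push_cast
    split_ifs with hvB
    · by_cases hv : v ∉ σ ∧ insert v σ ∈ X
      · obtain ⟨u, hu, hmem⟩ := exists_insert_erase_mem_spanned
          (mem_of_mem_simplices_succ hσ) hσc hvB hv.1 hv.2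
        have h1 : f (σ.erase u) v = 1 := by
          rw [hfeq, if_pos ⟨fun h => hv.1 (Finset.mem_of_mem_erase h), hmem⟩]
        have h2 := Finset.single_le_sum hfnn hu
        rw [h1] at h2
        nlinarith
      · rw [vertexWeight_eq, if_neg hv]; simp
    · nlinarith
  have hsum := Finset.sum_le_sum hlocal
  rw [sum_sum_vertexWeight_mul Y (fun _ => 1) k
    (fun τ u => ∑ v, vertexWeight X m (insert u τ) v * (1 - f τ v))] at hsum
  have htot := hsum.trans (Finset.sum_le_sum hcut)
  have hd1 : ∑ τ ∈ simplices Y k, d τ = (k + 1) * M := sum_sum_vertexWeight Y m k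
  rw [← Finset.mul_sum, Finset.sum_sub_distrib, hd1, Finset.sum_add_distrib, ← Finset.mul_sum,
    ← hMdef] at htot
  have hkpos : (0 : ℝ) < k + 1 := by positivity
  have hin' : ∑ τ ∈ simplices Y k, d τ ^ 2 / m τ = hInner X m k U * ((k + 1) * M) := by
    rw [hin, div_mul_cancel₀ _ (mul_pos hkpos hM).ne']
  rw [hin'] at htot
  have hfin : a * (1 - hInner X m k U) * ((k + 1) * M) ≤ (k + hOut X m k U) * M := by
    linarith
  have : a * (1 - hInner X m k U) * (k + 1) ≤ k + hOut X m k U :=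
    le_of_mul_le_mul_right (by linarith) hM
  rw [show (k : ℝ) / (k + 1) + 1 / (k + 1) * hOut X m k U = (k + hOut X m k U) / (k + 1) by ring,
    le_div_iff₀ hkpos]
  exact this

end

noncomputable section

variable {V : Type u} [Fintype V] [DecidableEq V] {X : PreAbstractSimplicialComplex V} {n k : ℕ}
  {m : Finset V → ℝ}

/-! ### Existence of the maximum -/

theorem mem_vertexSet {V : Type u} [Fintype V] {X : PreAbstractSimplicialComplex V} {v : V} :
    v ∈ vertexSet X ↔ {v} ∈ X := by
  simp [vertexSet]

/-- For vertices `v_0, …, v_{k+1}` of a simplex, the sets `U_i = {v_i}`, `i ≤ k`, have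
`h_inner < 1`: from the facet `v_1 ⋯ v_k` the walk can leave towards `v_{k+1}`. -/
theorem exists_hInner_lt_one (hX : IsPure X n) (hm : IsWeight X n m) (hk : k < n) :
    ∃ U : Fin (k + 1) → Finset V, (∀ i, U i ⊆ vertexSet X) ∧ (∀ i, (U i).Nonempty) ∧
      Pairwise (fun i j => Disjoint (U i) (U j)) ∧ setWeight X m U ≠ 0 ∧ hInner X m k U < 1 := by
  classical
  obtain ⟨-, t, ht, -⟩ := hX 0 ∅ (mem_simplices.2 ⟨Or.inl rfl, rfl⟩)
  obtain ⟨s, hst, hs⟩ := Finset.exists_subset_card_eq (s := t) (n := k + 2)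
    (by rw [(mem_simplices.1 ht).2]; omega)
  have hsub : ∀ r ⊆ s, r.Nonempty → r ∈ X := fun r hr hne =>
    mem_of_subset (mem_of_mem_simplices_succ ht) (hr.trans hst) hne
  let e := (s.equivFinOfCardEq hs).symm
  set g : Fin (k + 2) → V := fun i => (e i).1 with hg
  have hginj : Function.Injective g := Subtype.val_injective.comp e.injective
  have hgmem : ∀ i, g i ∈ s := fun i => (e i).2
  have hgsurj : ∀ v ∈ s, ∃ i, g i = v := fun v hv => ⟨e.symm ⟨v, hv⟩, by simp [hg]⟩
  set a := g 0 with ha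
  set b := g (Fin.last (k + 1)) with hb
  have hab : a ≠ b := fun h => (Fin.last_pos (n := k)).ne (hginj h)
  set U : Fin (k + 1) → Finset V := fun i => {g i.castSucc} with hUdef
  have hYX := spanned_subset (X := X) U
  set g' : Fin (k + 1) → V := fun i => g i.castSucc with hg'
  have hσ : s.erase b ∈ simplices (spanned X U) (k + 1) := by
    have hcard : (s.erase b).card = k + 1 := by rw [Finset.card_erase_of_mem (hgmem _), hs]; rfl
    have hinv : ∀ v ∈ s.erase b, g' (Function.invFun g' v) = v := by
      intro v hv
      obtain ⟨i, rfl⟩ := hgsurj v (Finset.mem_of_mem_erase hv)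
      have hi : i ≠ Fin.last (k + 1) := by
        rintro rfl
        exact Finset.ne_of_mem_erase hv rfl
      exact Function.invFun_eq ⟨i.castPred hi, by simp [hg']⟩
    refine mem_simplices.2 ⟨Or.inr ⟨hsub _ (Finset.erase_subset _ _) ?_, Function.invFun g',
      ?_, ?_⟩, hcard⟩
    · rw [← Finset.card_pos, hcard]; omega
    · intro v hv w hw hvw
      rw [← hinv v hv, ← hinv w hw, hvw]
    · intro v hv
      exact Finset.mem_singleton.2 (hinv v hv).symm
  have hU : 0 < setWeight X m U :=
    Finset.sum_pos (fun τ hτ => hm.pos hX (simplices_subset hYX hτ)) ⟨_, hσ⟩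
  refine ⟨U, fun i => ?_, fun i => Finset.singleton_nonempty _, fun i j hij => ?_, hU.ne', ?_⟩
  · exact Finset.singleton_subset_iff.2 (mem_vertexSet.2
      (hsub _ (Finset.singleton_subset_iff.2 (hgmem _)) (Finset.singleton_nonempty _)))
  · exact Finset.disjoint_singleton.2 fun h => hij (Fin.castSucc_injective _ (hginj h))
  · rw [hInner_eq hX hm hk hU.ne', div_lt_one (by positivity)]
    have hsum : ∑ τ ∈ simplices (spanned X U) k, ∑ u, vertexWeight (spanned X U) m τ u =
      (k + 1) * setWeight X m U := sum_sum_vertexWeight _ m k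
    rw [← hsum]
    have hpos : ∀ τ ∈ simplices (spanned X U) k, 0 < m τ := fun τ hτ =>
      hm.pos hX (simplices_subset hYX hτ)
    have htot : ∀ τ ∈ simplices (spanned X U) k, ∑ u, vertexWeight X m τ u = m τ := fun τ hτ => by
      have := mem_simplices.1 (simplices_subset hYX hτ)
      rw [hm.sum_vertexWeight (by omega), extWeight, if_pos this.1]
    have hle := vertexWeight_le hX hm hYX
    have hnn := vertexWeight_nonneg_of_subset hX hm hYX
    set τ := (s.erase b).erase a with hτdef
    have haσ : a ∈ s.erase b := Finset.mem_erase.2 ⟨hab, hgmem _⟩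
    have hτ : τ ∈ simplices (spanned X U) k := by
      have := mem_simplices_of_subset hσ (Finset.erase_subset a _)
      rwa [Finset.card_erase_of_mem haσ, (mem_simplices.1 hσ).2, Nat.add_sub_cancel] at this
    refine Finset.sum_lt_sum (fun ρ hρ => ?_) ⟨τ, hτ, ?_⟩
    · rw [div_le_iff₀ (hpos ρ hρ), sq]
      refine mul_le_mul_of_nonneg_left ?_ (Finset.sum_nonneg fun u _ => hnn ρ u)
      rw [← htot ρ hρ]
      exact Finset.sum_le_sum fun u _ => hle ρ u
    · have h1 : 0 < ∑ u, vertexWeight (spanned X U) m τ u := by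
        refine Finset.sum_pos' (fun u _ => hnn τ u) ⟨a, Finset.mem_univ _, ?_⟩
        rw [vertexWeight_eq, hτdef, Finset.insert_erase haσ,
          if_pos ⟨Finset.notMem_erase a _, mem_of_mem_simplices_succ hσ⟩]
        exact hm.pos hX (simplices_subset hYX hσ)
      have h2 : ∑ u, vertexWeight (spanned X U) m τ u < m τ := by
        rw [← htot τ hτ]
        refine Finset.sum_lt_sum (fun u _ => hle τ u) ⟨b, Finset.mem_univ _, ?_⟩
        have hbτ : b ∉ τ := fun h => Finset.notMem_erase b s (Finset.mem_of_mem_erase h)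
        have hbX : insert b τ ∈ X := hsub _ (Finset.insert_subset (hgmem _)
          ((Finset.erase_subset _ _).trans (Finset.erase_subset _ _))) (Finset.insert_nonempty _ _)
        have hbY : ¬ (b ∉ τ ∧ insert b τ ∈ spanned X U) := by
          rintro ⟨-, -, f, -, hf⟩
          have h3 := Finset.mem_singleton.1 (hf b (Finset.mem_insert_self b τ))
          exact (Fin.castSucc_lt_last (f b)).ne' (hginj h3)
        rw [vertexWeight_eq, vertexWeight_eq, if_neg hbY, if_pos ⟨hbτ, hbX⟩]
        exact hm.pos_of_mem hX hbX
      rw [div_lt_iff₀ (hpos τ hτ), sq]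
      exact mul_lt_mul_of_pos_left h2 h1

/-- Lower bounds on the nonzero spectra of the links of the `(k-1)`-simplices bound `h^k` from
below. -/
theorem isGreatest_higherCheeger (hX : IsPure X n) (hm : IsWeight X n m)
    (hconn : LinksConnected X n) (hk : k < n) {ε : ℝ} (hε : 0 ≤ ε)
    (h : LinkSpectrumGE X m k ((k : ℝ) / (k + 1) + ε)) :
    IsGreatest (cheegerSet X m k) (higherCheeger X m k) ∧ ε ≤ higherCheeger X m k := by
  have hpoincare : ∀ τ ∈ simplices X k, LinkPoincare X m τ ((k : ℝ) / (k + 1) + ε) := by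
    intro τ hτ
    have hc := (mem_simplices.1 hτ).2
    exact linkPoincare_of_spectrum hX hm (hc.symm ▸ hτ) (by omega) (hconn k hk τ hτ) (h τ hτ)
  have hmem : ε ∈ cheegerSet X m k := by
    refine ⟨hε, fun U _ _ _ hU => ?_⟩
    have := cheeger_inequality hX hm hk hpoincare hU
    linarith
  have hbdd : BddAbove (cheegerSet X m k) := by
    obtain ⟨U, h1, h2, h3, h4, h5⟩ := exists_hInner_lt_one hX hm hk
    refine ⟨((k : ℝ) / (k + 1) * hInner X m k U + 1 / ((k : ℝ) + 1) * hOut X m k U) /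
      (1 - hInner X m k U), ?_⟩
    rintro x ⟨-, hx⟩
    have := hx U h1 h2 h3 h4
    rw [le_div_iff₀ (by linarith)]
    linarith
  have hclosed : IsClosed (cheegerSet X m k) := by
    have : cheegerSet X m k = Set.Ici 0 ∩ ⋂ U ∈ {U : Fin (k + 1) → Finset V |
        (∀ i, U i ⊆ vertexSet X) ∧ (∀ i, (U i).Nonempty) ∧
        Pairwise (fun i j => Disjoint (U i) (U j)) ∧ setWeight X m U ≠ 0},
        {x : ℝ | x ≤ ((k : ℝ) / (k + 1) + x) * hInner X m k U +
          1 / ((k : ℝ) + 1) * hOut X m k U} := by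
      ext x
      simp only [cheegerSet, Set.mem_ofPred_eq, Set.mem_inter_iff, Set.mem_Ici, Set.mem_iInter,
        and_imp]
    rw [this]
    refine isClosed_Ici.inter (isClosed_biInter fun U _ => ?_)
    exact isClosed_le continuous_id (by fun_prop)
  exact ⟨⟨hclosed.csSup_mem ⟨ε, hmem⟩ hbdd, fun x hx => le_csSup hbdd hx⟩, le_csSup hbdd hmem⟩

/-! ### The homogeneous weight -/

theorem homogeneousWeight_isWeight (hX : IsPure X n) : IsWeight X n (homogeneousWeight X n) := by
  classical
  refine ⟨fun j _ τ hτ => ?_, fun j hj τ hτ => ?_⟩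
  · obtain ⟨-, t, ht, hτt⟩ := hX j τ hτ
    have h1 : 0 < ((simplices X (n + 1)).filter fun σ => τ ⊆ σ).card :=
      Finset.card_pos.2 ⟨t, Finset.mem_filter.2 ⟨ht, hτt⟩⟩
    have h2 := Nat.factorial_pos (n + 1 - τ.card)
    unfold homogeneousWeight
    positivity
  · have hc := (mem_simplices.1 hτ).2
    rw [sum_simplices_superset X _ hc]
    have hterm : ∀ u, vertexWeight X (homogeneousWeight X n) τ u = ((n - j).factorial : ℝ) *
        ∑ ρ ∈ simplices X (n + 1), if τ ⊆ ρ ∧ u ∈ ρ \ τ then 1 else 0 := by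
      intro u
      rw [vertexWeight_eq]
      by_cases hu : u ∈ τ
      · simp [hu]
      · by_cases hi : insert u τ ∈ X
        · rw [if_pos ⟨hu, hi⟩, homogeneousWeight, Finset.card_insert_of_notMem hu, hc,
            show n + 1 - (j + 1) = n - j by omega, ← Finset.sum_boole]
          simp [hu, Finset.insert_subset_iff, and_comm]
        · rw [if_neg (fun h => hi h.2), Finset.sum_eq_zero, mul_zero]
          intro ρ hρ
          rw [if_neg]
          rintro ⟨h1, h2⟩
          exact hi (mem_of_subset (mem_of_mem_simplices_succ hρ)
            (Finset.insert_subset (Finset.mem_sdiff.1 h2).1 h1) (Finset.insert_nonempty _ _))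
    simp only [hterm]
    rw [← Finset.mul_sum, Finset.sum_comm]
    have hcount : ∀ ρ ∈ simplices X (n + 1), (∑ u, if τ ⊆ ρ ∧ u ∈ ρ \ τ then (1 : ℝ) else 0) =
        ((n + 1 - j : ℕ) : ℝ) * if τ ⊆ ρ then 1 else 0 := by
      intro ρ hρ
      by_cases h : τ ⊆ ρ
      · simp only [h, true_and, if_true, mul_one, Finset.sum_boole]
        rw [← (mem_simplices.1 hρ).2, ← hc, ← Finset.card_sdiff_of_subset h]
        congr 2
        ext u; simp
      · simp [h]
    rw [Finset.sum_congr rfl hcount, ← Finset.mul_sum, Finset.sum_boole, homogeneousWeight, hc,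
      ← mul_assoc]
    congr 1
    rw [show n + 1 - j = (n - j) + 1 by omega, Nat.factorial_succ]
    push_cast
    ring

theorem homogeneousWeight_top {s : Finset V} (hs : s ∈ simplices X (n + 1)) :
    homogeneousWeight X n s = 1 := by
  have hc := (mem_simplices.1 hs).2
  have : (simplices X (n + 1)).filter (fun σ => s ⊆ σ) = {s} := by
    ext σ
    simp only [Finset.mem_filter, Finset.mem_singleton]
    constructor
    · rintro ⟨h1, h2⟩
      exact (Finset.eq_of_subset_of_card_le h2 (by rw [hc, (mem_simplices.1 h1).2])).symm
    · rintro rfl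
      exact ⟨hs, subset_rfl⟩
  simp [homogeneousWeight, this, hc]

open scoped Classical in
/-- Eigenfunctions of the random walk Laplacian of a graph become eigenvectors of the normalized
Laplacian after multiplication by the square root of the degree. -/
theorem spectralGap_le {W : Type u} [Fintype W] (G : SimpleGraph W) {d : W → ℝ}
    (hd : ∀ u, ∑ v, (if G.Adj u v then (1 : ℝ) else 0) = d u) (hpos : ∀ u, 0 < d u) {μ : ℝ}
    (hμ : 0 < μ) {g : W → ℝ} (hg : g ≠ 0)
    (h : ∀ u, ∑ v, (if G.Adj u v then g v else 0) = (1 - μ) * (d u * g u)) :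
    spectralGap G ≤ μ := by
  have hdeg : ∀ u, (G.degree u : ℝ) = d u := fun u => by
    rw [← hd, Finset.sum_boole, ← G.card_neighborFinset_eq_degree, G.neighborFinset_eq_filter]
  have hs0 : ∀ u, Real.sqrt (d u) ≠ 0 := fun u => (Real.sqrt_pos.2 (hpos u)).ne'
  refine csInf_le ⟨0, fun x hx => hx.1.le⟩ ⟨hμ, ?_⟩
  rw [← Matrix.spectrum_toLin']
  refine (Module.End.hasEigenvalue_of_hasEigenvector
    (x := fun u => Real.sqrt (d u) * g u) ⟨?_, ?_⟩).mem_spectrum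
  · rw [Module.End.mem_eigenspace_iff]
    ext u
    rw [Matrix.toLin'_apply, Matrix.mulVec, dotProduct]
    have hterm : ∀ v, normalizedLaplacian G u v * (Real.sqrt (d v) * g v) =
        (if u = v then Real.sqrt (d v) * g v else 0) -
          1 / Real.sqrt (d u) * (if G.Adj u v then g v else 0) := by
      intro v
      simp only [normalizedLaplacian, Matrix.of_apply, hdeg]
      by_cases huv : u = v
      · subst huv; simp
      · by_cases hadj : G.Adj u v
        · simp only [huv, hadj, if_true, if_false]
          rw [Real.sqrt_mul (hpos u).le]
          have := hs0 u
          have := hs0 v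
          field_simp
          ring
        · simp [huv, hadj]
    simp only [hterm, Finset.sum_sub_distrib, ← Finset.mul_sum, h, Finset.sum_ite_eq,
      Finset.mem_univ, if_true, Pi.smul_apply, smul_eq_mul]
    have h1 := Real.mul_self_sqrt (hpos u).le
    have h2 := hs0 u
    field_simp
    linear_combination (-(1 - μ)) * g u * (-h1)
  · intro h0
    refine hg (funext fun u => ?_)
    have := congrFun h0 u
    simpa [hs0 u] using this

open scoped Classical in
theorem linkSpectrumGE_of_spectralGap (hX : IsPure X n) (hn : 0 < n) {lam : ℝ}
    (h : ∀ τ ∈ simplices X (n - 1), lam ≤ spectralGap (skeleton (link X τ))) :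
    LinkSpectrumGE X (homogeneousWeight X n) (n - 1) lam := by
  have hm := homogeneousWeight_isWeight hX
  rintro τ hτ μ ⟨hμ, hμ0⟩
  have hc := (mem_simplices.1 hτ).2
  have hμpos : 0 < μ := lt_of_le_of_ne (eigenvalue_nonneg hX hm hμ) (Ne.symm hμ0)
  obtain ⟨f, ⟨u₀, hu₀, hf₀⟩, heq⟩ := exists_eigenfunction hX hm hμ
  set M := homogeneousWeight X n
  have hedge : ∀ u v : {v : V // ({v} : Finset V) ∈ link X τ}, edgeWeight X M τ u.1 v.1 =
      if (skeleton (link X τ)).Adj u v then 1 else 0 := by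
    intro u v
    rw [edgeWeight_eq]
    simp only [skeleton_link_adj]
    split_ifs with h1
    · refine homogeneousWeight_top (mem_simplices.2 ⟨Or.inr h1.2.2.2, ?_⟩)
      rw [Finset.card_insert_of_notMem (by simp [h1.2.1, h1.2.2.1.symm]),
        Finset.card_insert_of_notMem h1.1, hc]
      omega
    · rfl
  have hsum : ∀ (u : V) (F : V → ℝ), ∑ v : {v : V // ({v} : Finset V) ∈ link X τ},
      edgeWeight X M τ u v.1 * F v.1 = ∑ v, edgeWeight X M τ u v * F v := fun u F =>
    sum_subtype_of_eq_zero _ (fun v => edgeWeight X M τ u v * F v) fun v hv => by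
      rw [edgeWeight_comm, edgeWeight_eq_zero_left hv, zero_mul]
  have hdeg := hm.sum_edgeWeight (τ := τ) (by omega)
  refine (h τ hτ).trans ?_
  refine (spectralGap_le (skeleton (link X τ)) (d := fun u => vertexWeight X M τ u.1)
    (g := fun u => f u.1) (fun u => ?_) (fun u => ?_)
    hμpos (fun h0 => hf₀ (congrFun h0 ⟨u₀, hu₀⟩)) fun u => ?_)
  · have := hsum u.1 fun _ => 1
    simp only [mul_one, hedge, hdeg] at this
    exact this
  · rw [vertexWeight_of_mem u.2]
    exact hm.pos_of_mem hX (singleton_mem_link.1 u.2).2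
  · have h1 := hsum u.1 f
    have h2 := heq u.1
    simp only [mul_sub, Finset.sum_sub_distrib, ← Finset.sum_mul, hdeg] at h2
    simp only [hedge, ite_mul, one_mul, zero_mul] at h1
    rw [h1]
    linarith

/-! ### The constants -/

/-- The lower bound for `h^k` in terms of the spectral gap `lam` in dimension `n - 2`, for
`k < n`. -/
def cheegerBound (n k : ℕ) (lam : ℝ) : ℝ := trickledGap (n - 1 - k) lam - k / (k + 1)

theorem cheegerBound_pos (hk : k < n) {lam : ℝ} (hlam : ((n : ℝ) - 1) / n < lam) :
    0 < cheegerBound n k lam := by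
  have p0 := one_sub_mul_pos hlam (i := n - 1 - k) (by omega)
  have pn := one_sub_mul_pos hlam (i := n) le_rfl
  have hnk : (n : ℝ) = (n - 1 - k : ℕ) + 1 + k := by exact_mod_cast (by omega)
  rw [cheegerBound, sub_pos, trickledGap, div_lt_div_iff₀ (by positivity) p0]
  rw [hnk] at pn
  linarith

theorem tendsto_cheegerBound (n k : ℕ) :
    Filter.Tendsto (cheegerBound n k) (nhds 1) (nhds (1 / ((k : ℝ) + 1))) := by
  have h1 : cheegerBound n k 1 = 1 / ((k : ℝ) + 1) := by
    simp only [cheegerBound, trickledGap, sub_self, mul_zero, sub_zero, div_one]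
    field_simp
    ring
  have hc : ContinuousAt (cheegerBound n k) 1 := by
    unfold cheegerBound trickledGap
    refine ContinuousAt.sub (ContinuousAt.div (by fun_prop) (by fun_prop) (by simp)) (by fun_prop)
  rw [← h1]
  exact hc

theorem cheegerBound_le_higherCheeger (hX : IsPure X n) (hm : IsWeight X n m)
    (hconn : LinksConnected X n) (hk : k < n) {lam : ℝ} (hlam : ((n : ℝ) - 1) / n < lam)
    (h : LinkSpectrumGE X m (n - 1) lam) :
    IsGreatest (cheegerSet X m k) (higherCheeger X m k) ∧
      cheegerBound n k lam ≤ higherCheeger X m k := by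
  have h1 := linkSpectrumGE_trickledGap hX hm hconn hlam h (i := n - 1 - k) (by omega)
  rw [show n - 1 - (n - 1 - k) = k by omega] at h1
  refine isGreatest_higherCheeger hX hm hconn hk (cheegerBound_pos hk hlam).le ?_
  rwa [cheegerBound, add_sub_cancel]

end

end HDX

theorem theorem2p3 :
    -- a spectral gap in the links of the `(k-1)`-simplices bounds `h^k` from below
    (∀ (V : Type u) [Fintype V] [DecidableEq V] (X : PreAbstractSimplicialComplex V)
      (m : Finset V → ℝ) (n k : ℕ) (ε : ℝ),
      HDX.IsPure X n → HDX.IsWeight X n m → HDX.LinksConnected X n → k < n → 0 < ε →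
      HDX.LinkSpectrumGE X m k ((k : ℝ) / (k + 1) + ε) →
      IsGreatest (HDX.cheegerSet X m k) (HDX.higherCheeger X m k) ∧
        ε ≤ HDX.higherCheeger X m k) ∧
    -- constants `εk n k lam` depending on `n`, `k` and `lam` only
    (∃ εk : ℕ → ℕ → ℝ → ℝ,
      (∀ (n k : ℕ), k < n →
        (∀ lam : ℝ, ((n : ℝ) - 1) / n < lam → 0 < εk n k lam) ∧
        Filter.Tendsto (εk n k) (nhds 1) (nhds (1 / ((k : ℝ) + 1)))) ∧
      -- weighted complexes
      (∀ (V : Type u) [Fintype V] [DecidableEq V] (X : PreAbstractSimplicialComplex V)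
        (m : Finset V → ℝ) (n k : ℕ) (lam : ℝ),
        HDX.IsPure X n → HDX.IsWeight X n m → HDX.LinksConnected X n → k < n →
        ((n : ℝ) - 1) / n < lam → HDX.LinkSpectrumGE X m (n - 1) lam →
        IsGreatest (HDX.cheegerSet X m k) (HDX.higherCheeger X m k) ∧
          εk n k lam ≤ HDX.higherCheeger X m k) ∧
      -- local spectral expansion, with the homogeneous weight
      (∀ (V : Type u) [Fintype V] [DecidableEq V] (X : PreAbstractSimplicialComplex V)
        (n k : ℕ) (lam : ℝ),
        HDX.LocalSpectralExpansion X n lam → k < n →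
        IsGreatest (HDX.cheegerSet X (HDX.homogeneousWeight X n) k)
            (HDX.higherCheeger X (HDX.homogeneousWeight X n) k) ∧
          εk n k lam ≤ HDX.higherCheeger X (HDX.homogeneousWeight X n) k)) := by
  refine ⟨fun V _ _ X m n k ε hX hm hconn hk hε h =>
    HDX.isGreatest_higherCheeger hX hm hconn hk hε.le h, HDX.cheegerBound, fun n k hk =>
      ⟨fun lam hlam => HDX.cheegerBound_pos hk hlam, HDX.tendsto_cheegerBound n k⟩,
    fun V _ _ X m n k lam hX hm hconn hk hlam h =>
      HDX.cheegerBound_le_higherCheeger hX hm hconn hk hlam h, ?_⟩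
  rintro V _ _ X n k lam ⟨hlam, hX, hconn, hgap⟩ hk
  exact HDX.cheegerBound_le_higherCheeger hX (HDX.homogeneousWeight_isWeight hX) hconn hk hlam
    (HDX.linkSpectrumGE_of_spectralGap hX (by omega) hgap)
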